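/- Let $G$ be a connected (finite-dimensional, real) Lie group with Lie algebra $\mathfrak g$, let $H\subset G$ be a closed subgroup with Lie algebra $\mathfrak h$, and equip $M=G/H$ with its quotient manifold structure, i.e. the one for which the projection $p:G\to G/H$ is a smooth submersion. Write $\bar e=p(e)$ and $\lambda_g(aH)=gaH$ for $g,a\in G$. Suppose that $(G,H)$ is a symmetric pair: there is a linear subspace $\mathfrak m\subset\mathfrak g$ with $$\mathfrak g=\mathfrak h\oplus\mathfrak m,\qquad \mathrm{Ad}_a(\mathfrak m)=\mathfrak m\ \ (a\in H),\qquad [\mathfrak m,\mathfrak m]\subset\mathfrak h .$$ Let $(\wedge^2\mathfrak m)^H$ be the space of bivectors $r\in\wedge^2\mathfrak m$ with $\wedge^2(\mathrm{Ad}_a|_{\mathfrak m})\,r=r$ for all $a\in H$. A $G$-invariant Poisson structure on $G/H$ is a smooth bivector field $\pi$ on $G/H$ whose Schouten--Nijenhuis bracket with itself vanishes, $[\pi,\pi]_S=0$, and which satisfies $(\lambda_g)_*\pi=\pi$ for all $g\in G$. Then every $r\in(\wedge^2\mathfrak m)^H$ defines a $G$-invariant Poisson structure $\pi^r$ on $G/H$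 by $$\pi^r(gH)=\wedge^2\big(T_{\bar e}\lambda_g\circ T_ep|_{\mathfrak m}\big)\,r\qquad(g\in G),$$ and $r\mapsto\pi^r$ is a bijection from $(\wedge^2\mathfrak m)^H$ onto the set of all $G$-invariant Poisson structures on $G/H$. -/

import Mathlib

open scoped Manifold ContDiff

noncomputable section

/-! ### Bivectors on a vector space -/

section Bivector

/-- The value `r(α, β)` of a bivector `r ∈ ∧²V` on two covectors; on decomposable bivectors,
`(v ∧ w)(α, β) = α(v) β(w) - α(w) β(v)`. -/
def bivectorEval {V : Type*} [AddCommGroup V] [Module ℝ V]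
    (r : ⋀[ℝ]^2 V) (α β : Module.Dual ℝ V) : ℝ :=
  exteriorPower.pairingDual ℝ V 2 (exteriorPower.ιMulti ℝ 2 ![α, β]) r

theorem bivectorEval_ιMulti {V : Type*} [AddCommGroup V] [Module ℝ V]
    (v w : V) (α β : Module.Dual ℝ V) :
    bivectorEval (exteriorPower.ιMulti ℝ 2 ![v, w]) α β = α v * β w - α w * β v := by
  simp [bivectorEval, exteriorPower.pairingDual_ιMulti_ιMulti, Matrix.det_fin_two]
  ring

/-- The Schouten-Nijenhuis bracket `[P, Q]_S` of two bivector fields on a vector space, at the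
point `x`, as a function of three (constant) covectors. In linear coordinates,
`[P, Q]^{ijk} = ∑ₗ (P^{lk} ∂ₗ Q^{ij} + Q^{lk} ∂ₗ P^{ij}) + cyclic permutations of (i, j, k)`:
here `∑ₗ P^{lk} ∂ₗ Q^{ij}` is `P (d(Q^{ij}), dx^k)`. -/
def vectorSpaceSchouten {F : Type*} [NormedAddCommGroup F] [NormedSpace ℝ F]
    (P Q : F → ⋀[ℝ]^2 F) (x : F) (α β γ : Module.Dual ℝ F) : ℝ :=
  let S : Module.Dual ℝ F → Module.Dual ℝ F → Module.Dual ℝ F → ℝ := fun a b c ↦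
    bivectorEval (P x) (fderiv ℝ (fun y ↦ bivectorEval (Q y) a b) x : F →ₗ[ℝ] ℝ) c +
    bivectorEval (Q x) (fderiv ℝ (fun y ↦ bivectorEval (P y) a b) x : F →ₗ[ℝ] ℝ) c
  S α β γ + S β γ α + S γ α β

end Bivector

/-! ### Bivector fields and Poisson structures on a manifold -/

section Manifold

/-- A (not necessarily smooth) bivector field on a manifold: a section of `∧² TM`. -/
abbrev BivectorField (F : Type*) [NormedAddCommGroup F] [NormedSpace ℝ F]
    (M : Type*) [TopologicalSpace M] [ChartedSpace F M] : Type _ :=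
  ∀ x : M, ⋀[ℝ]^2 (TangentSpace 𝓘(ℝ, F) x)

namespace BivectorField

variable {F : Type*} [NormedAddCommGroup F] [NormedSpace ℝ F]
  {M : Type*} [TopologicalSpace M] [ChartedSpace F M]

/-- The expression of a bivector field in the preferred chart at `x₀`
(meaningful on the target of the chart). -/
def inChart (π : BivectorField F M) (x₀ : M) (y : F) : ⋀[ℝ]^2 F :=
  exteriorPower.map 2
    (mfderiv 𝓘(ℝ, F) 𝓘(ℝ, F) (extChartAt 𝓘(ℝ, F) x₀)
      ((extChartAt 𝓘(ℝ, F) x₀).symm y)).toLinearMap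
    (π ((extChartAt 𝓘(ℝ, F) x₀).symm y))

/-- A bivector field is smooth if its components in charts are smooth. -/
def IsSmooth (π : BivectorField F M) : Prop :=
  ∀ (x₀ : M) (α β : Module.Dual ℝ F),
    ContDiffOn ℝ ∞ (fun y ↦ bivectorEval (π.inChart x₀ y) α β) (extChartAt 𝓘(ℝ, F) x₀).target

/-- The Schouten-Nijenhuis bracket `[π, ρ]_S` at the point `x₀`, as a function of three covectors
at `x₀`; it is computed in the chart at `x₀`. -/
def schouten (π ρ : BivectorField F M) (x₀ : M)
    (α β γ : Module.Dual ℝ (TangentSpace 𝓘(ℝ, F) x₀)) : ℝ :=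
  let toChart : Module.Dual ℝ (TangentSpace 𝓘(ℝ, F) x₀) → Module.Dual ℝ F := fun a ↦
    a ∘ₗ ((mfderiv 𝓘(ℝ, F) 𝓘(ℝ, F) (extChartAt 𝓘(ℝ, F) x₀) x₀).inverse).toLinearMap
  vectorSpaceSchouten (π.inChart x₀) (ρ.inChart x₀) (extChartAt 𝓘(ℝ, F) x₀ x₀)
    (toChart α) (toChart β) (toChart γ)

/-- A Poisson structure: a smooth bivector field `π` with `[π, π]_S = 0`. -/
structure IsPoisson (π : BivectorField F M) : Prop where
  isSmooth : π.IsSmooth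
  schouten_self : ∀ (x : M) (α β γ : Module.Dual ℝ (TangentSpace 𝓘(ℝ, F) x)),
    schouten π π x α β γ = 0

/-- Invariance of a bivector field under a group action: `(λ_g)_* π = π` for every `g`. -/
def IsInvariant (G : Type*) [Group G] [MulAction G M] (π : BivectorField F M) : Prop :=
  ∀ (g : G) (x : M), π (g • x) =
    exteriorPower.map 2 (mfderiv 𝓘(ℝ, F) 𝓘(ℝ, F) (fun y : M ↦ g • y) x).toLinearMap (π x)

end BivectorField

end Manifold

/-! ### Lie groups and closed subgroups -/

section LieGroup

variable {E : Type*} [NormedAddCommGroup E] [NormedSpace ℝ E]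
  {G : Type*} [TopologicalSpace G] [ChartedSpace E G] [Group G]

/-- The adjoint action of `a` on the Lie algebra `𝔤 = T₁G`: the differential at `1` of
`x ↦ a x a⁻¹`. -/
def groupAd (a : G) :
    GroupLieAlgebra 𝓘(ℝ, E) G →L[ℝ] GroupLieAlgebra 𝓘(ℝ, E) G :=
  mfderiv 𝓘(ℝ, E) 𝓘(ℝ, E) (fun x : G ↦ a * x * a⁻¹) 1

/-- `u ∈ 𝔤` is the velocity at `0` of a smooth curve through `1` which stays in `H`. -/
def IsTangentToSubgroup (H : Subgroup G) (u : GroupLieAlgebra 𝓘(ℝ, E) G) : Prop :=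
  ∃ γ : ℝ → G, ContMDiff 𝓘(ℝ, ℝ) 𝓘(ℝ, E) ∞ γ ∧ γ 0 = 1 ∧ (∀ t, γ t ∈ H) ∧
    mfderiv 𝓘(ℝ, ℝ) 𝓘(ℝ, E) γ 0 (1 : ℝ) = u


theorem IsTangentToSubgroup.zero (H : Subgroup G) :
    IsTangentToSubgroup H (0 : GroupLieAlgebra 𝓘(ℝ, E) G) := by
  refine ⟨fun _ ↦ 1, contMDiff_const, rfl, fun _ ↦ H.one_mem, ?_⟩
  simp only [mfderiv_const]
  rfl

theorem IsTangentToSubgroup.smul (H : Subgroup G) (c : ℝ) {u : GroupLieAlgebra 𝓘(ℝ, E) G}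
    (hu : IsTangentToSubgroup H u) : IsTangentToSubgroup H (c • u) := by
  obtain ⟨γ, hγ, h1, hH, rfl⟩ := hu
  have hs : ContMDiff 𝓘(ℝ, ℝ) 𝓘(ℝ, ℝ) ∞ (fun t : ℝ ↦ c * t) :=
    (contDiff_const.mul contDiff_id).contMDiff
  refine ⟨fun t ↦ γ (c * t), hγ.comp hs, by simpa using h1, fun t ↦ hH _, ?_⟩
  have hd : HasMFDerivAt 𝓘(ℝ, ℝ) 𝓘(ℝ, ℝ) (fun t : ℝ ↦ c * t) 0
      (c • ContinuousLinearMap.id ℝ ℝ) := by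
    simpa using ((hasFDerivAt_id (0 : ℝ)).const_mul c).hasMFDerivAt
  have h0 : c * (0 : ℝ) = 0 := mul_zero c
  have hg : HasMFDerivAt 𝓘(ℝ, ℝ) 𝓘(ℝ, E) γ (c * 0) (mfderiv 𝓘(ℝ, ℝ) 𝓘(ℝ, E) γ 0) := by
    have := (hγ.mdifferentiableAt (by simp) (x := (0 : ℝ))).hasMFDerivAt
    rw [h0]
    exact this
  have h2 := (HasMFDerivAt.comp (0 : ℝ) hg hd).mfderiv
  have h3 : mfderiv 𝓘(ℝ, ℝ) 𝓘(ℝ, E) (fun t ↦ γ (c * t)) 0 =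
      (mfderiv 𝓘(ℝ, ℝ) 𝓘(ℝ, E) γ 0).comp (c • ContinuousLinearMap.id ℝ ℝ) := h2
  rw [h3]
  change (mfderiv 𝓘(ℝ, ℝ) 𝓘(ℝ, E) γ 0) (c • (1 : ℝ)) = _
  exact ContinuousLinearMap.map_smul _ c (1 : ℝ)

theorem IsTangentToSubgroup.add [LieGroup 𝓘(ℝ, E) ∞ G] (H : Subgroup G)
    {u v : GroupLieAlgebra 𝓘(ℝ, E) G}
    (hu : IsTangentToSubgroup H u) (hv : IsTangentToSubgroup H v) :
    IsTangentToSubgroup H (u + v) := by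
  obtain ⟨γ, hγ, h1, hH, rfl⟩ := hu
  obtain ⟨δ, hδ, k1, kH, rfl⟩ := hv
  refine ⟨fun t ↦ γ t * δ t, hγ.mul hδ, by simp [h1, k1],
    fun t ↦ H.mul_mem (hH t) (kH t), ?_⟩
  have dγ : MDifferentiableAt 𝓘(ℝ, ℝ) 𝓘(ℝ, E) γ 0 := hγ.mdifferentiableAt (by simp)
  have dδ : MDifferentiableAt 𝓘(ℝ, ℝ) 𝓘(ℝ, E) δ 0 := hδ.mdifferentiableAt (by simp)
  have dm : MDifferentiableAt (𝓘(ℝ, E).prod 𝓘(ℝ, E)) 𝓘(ℝ, E)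
      (fun p : G × G ↦ p.1 * p.2) (γ 0, δ 0) :=
    (contMDiff_mul 𝓘(ℝ, E) ∞).mdifferentiableAt (by simp)
  have h2 : mfderiv 𝓘(ℝ, ℝ) 𝓘(ℝ, E) (fun t ↦ γ t * δ t) 0 (1 : ℝ) =
      mfderiv (𝓘(ℝ, E).prod 𝓘(ℝ, E)) 𝓘(ℝ, E) (fun p : G × G ↦ p.1 * p.2) (γ 0, δ 0)
        (mfderiv 𝓘(ℝ, ℝ) 𝓘(ℝ, E) γ 0 (1 : ℝ), mfderiv 𝓘(ℝ, ℝ) 𝓘(ℝ, E) δ 0 (1 : ℝ)) := by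
    have h3 := (HasMFDerivAt.comp (0 : ℝ) dm.hasMFDerivAt
      (dγ.hasMFDerivAt.prodMk dδ.hasMFDerivAt)).mfderiv
    change mfderiv 𝓘(ℝ, ℝ) 𝓘(ℝ, E)
      ((fun p : G × G ↦ p.1 * p.2) ∘ fun t ↦ (γ t, δ t)) 0 (1 : ℝ) = _
    rw [h3]
    rfl
  have e1 : (fun z : G ↦ z * δ 0) = id := by funext z; simp [k1]
  have e2 : (fun z : G ↦ γ 0 * z) = id := by funext z; simp [h1]
  refine (h2.trans (mfderiv_prod_eq_add_apply dm)).trans ?_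
  have key : ∀ f : G → G, f = id → ∀ (x : G) (w : TangentSpace 𝓘(ℝ, E) x),
      (mfderiv 𝓘(ℝ, E) 𝓘(ℝ, E) f x w : E) = w := by
    rintro _ rfl x w
    rw [mfderiv_id]
    rfl
  exact congrArg₂ (fun a b : E ↦ a + b) (key _ e1 _ _) (key _ e2 _ _)

/-- The Lie algebra `𝔥 = T₁H ⊆ 𝔤` of a closed subgroup `H`. -/
def subgroupLieAlgebra [LieGroup 𝓘(ℝ, E) ∞ G] (H : Subgroup G) :
    Submodule ℝ (GroupLieAlgebra 𝓘(ℝ, E) G) where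
  carrier := {u | IsTangentToSubgroup H u}
  zero_mem' := IsTangentToSubgroup.zero H
  add_mem' hu hv := IsTangentToSubgroup.add H hu hv
  smul_mem' c _ hu := IsTangentToSubgroup.smul H c hu

/-- The pair `(G, H)` is symmetric with canonical decomposition `𝔤 = 𝔥 ⊕ 𝔪`:
`Ad_a(𝔪) = 𝔪` for `a ∈ H`, and `[𝔪, 𝔪] ⊆ 𝔥`. -/
structure IsSymmetricDecomposition [LieGroup 𝓘(ℝ, E) ∞ G] (H : Subgroup G)
    (m : Submodule ℝ (GroupLieAlgebra 𝓘(ℝ, E) G)) : Prop where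
  isCompl : IsCompl (subgroupLieAlgebra H) m
  map_groupAd : ∀ a ∈ H, m.map (groupAd (E := E) a).toLinearMap = m
  lie_mem : ∀ u ∈ m, ∀ v ∈ m, ⁅u, v⁆ ∈ subgroupLieAlgebra H

/-- The restriction of `Ad_a`, `a ∈ H`, to `𝔪`. -/
def IsSymmetricDecomposition.groupAdRestrict [LieGroup 𝓘(ℝ, E) ∞ G] {H : Subgroup G}
    {m : Submodule ℝ (GroupLieAlgebra 𝓘(ℝ, E) G)} (h : IsSymmetricDecomposition H m)
    (a : H) : m →ₗ[ℝ] m :=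
  (groupAd (E := E) (a : G)).toLinearMap.restrict
    (fun _ hu ↦ (h.map_groupAd a a.2).le (Submodule.mem_map_of_mem hu))

/-- The space `(∧²𝔪)^H` of `Ad(H)`-invariant bivectors. -/
def IsSymmetricDecomposition.invariantBivectors [LieGroup 𝓘(ℝ, E) ∞ G] {H : Subgroup G}
    {m : Submodule ℝ (GroupLieAlgebra 𝓘(ℝ, E) G)} (h : IsSymmetricDecomposition H m) :
    Submodule ℝ (⋀[ℝ]^2 m) where
  carrier := {r | ∀ a : H, exteriorPower.map 2 (h.groupAdRestrict a) r = r}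
  zero_mem' _ := map_zero _
  add_mem' hr hs a := by rw [map_add, hr a, hs a]
  smul_mem' c _ hr a := by rw [map_smul, hr a]

end LieGroup

/-! ### The homogeneous space `G/H` -/

section Quotient

variable {E : Type*} [NormedAddCommGroup E] [NormedSpace ℝ E]
  {G : Type*} [TopologicalSpace G] [ChartedSpace E G] [Group G]
  {H : Subgroup G}

/-- For `g ∈ G`, the linear map `𝔪 → T_{gH}(G/H)`, `u ↦ T_ē λ_g (T_e p (u))`, where `p : G → G/H`
is the projection, `ē = p(e)` and `λ_g` is the translation by `g` on `G/H`. -/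
def translateToQuotient (F : Type*) [NormedAddCommGroup F] [NormedSpace ℝ F]
    [ChartedSpace F (G ⧸ H)] (m : Submodule ℝ (GroupLieAlgebra 𝓘(ℝ, E) G)) (g : G) :
    m →ₗ[ℝ] TangentSpace 𝓘(ℝ, F) (g • ((1 : G) : G ⧸ H)) :=
  (mfderiv 𝓘(ℝ, F) 𝓘(ℝ, F) (fun x : G ⧸ H ↦ g • x) ((1 : G) : G ⧸ H)).toLinearMap ∘ₗ
    (mfderiv 𝓘(ℝ, E) 𝓘(ℝ, F) (fun a : G ↦ (a : G ⧸ H)) 1).toLinearMap ∘ₗ m.subtype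

end Quotient

end

/-! Evaluation at `ē` identifies invariant bivector fields with `H`-fixed bivectors on `T_ē(G/H)`.
The map `T_e p` has kernel `𝔥` (`mem_subgroupLieAlgebra_iff`), hence restricts to an isomorphism on
`𝔪` (`projTangent_bijective`), and it turns the isotropy action of `a ∈ H` into `Ad_a`
(`translateToModel_mul_mem`). This gives the bijection with `(∧²𝔪)^H`, apart from smoothness and the
Poisson condition, which turn out to be automatic.

Both are checked on `G`. Let `φ` be a chart of `G/H`, `(eᵢ)` a basis of `𝔪` and `Aᵢ` the derivative
of `φ ∘ p` along the left-invariant field of `eᵢ`. The components of `π^r` pulled back to `G` are `∑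
rⁱʲ α(Aᵢ) β(Aⱼ)` with constant `rⁱʲ` (`bivectorEval_inChart`), and smoothness follows by composing
with local sections of `p`. The Schouten bracket involves only the `Aᵢ` and the second derivatives
`Dₖᵢ` of `φ ∘ p` along `eₖ` and `eᵢ`. Since `[𝔪, 𝔪] ⊆ 𝔥` and left-invariant fields from `𝔥` kill
functions lifted from `G/H`, `D` is symmetric (`chartDeriv_commutator`). Skewness of `r` then
cancels the cyclic sum (`cyclic_sum_eq_zero`). -/

noncomputable section
-- Bivector algebra and the cyclic cancellation.
section BivectorAlgebra

variable {V W : Type*} [AddCommGroup V] [Module ℝ V] [AddCommGroup W] [Module ℝ W]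

theorem bivectorEval_add (r s : ⋀[ℝ]^2 V) (α β : Module.Dual ℝ V) :
    bivectorEval (r + s) α β = bivectorEval r α β + bivectorEval s α β :=
  map_add _ r s

theorem bivectorEval_smul (c : ℝ) (r : ⋀[ℝ]^2 V) (α β : Module.Dual ℝ V) :
    bivectorEval (c • r) α β = c * bivectorEval r α β :=
  map_smul _ c r

theorem bivectorEval_zero (α β : Module.Dual ℝ V) : bivectorEval (0 : ⋀[ℝ]^2 V) α β = 0 :=
  map_zero _

/-- Induction principle for bivectors. -/
theorem bivector_induction {p : ⋀[ℝ]^2 V → Prop}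
    (wedge : ∀ v w, p (exteriorPower.ιMulti ℝ 2 ![v, w])) (zero : p 0)
    (add : ∀ r s, p r → p s → p (r + s)) (smul : ∀ (c : ℝ) r, p r → p (c • r))
    (r : ⋀[ℝ]^2 V) : p r := by
  have hr : r ∈ Submodule.span ℝ (Set.range (exteriorPower.ιMulti ℝ 2 (M := V))) := by
    rw [exteriorPower.ιMulti_span]; trivial
  induction hr using Submodule.span_induction with
  | mem x hx =>
    obtain ⟨v, rfl⟩ := hx
    have : v = ![v 0, v 1] := by ext i; fin_cases i <;> rfl
    rw [this]
    exact wedge _ _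
  | zero => exact zero
  | add x y _ _ hx hy => exact add x y hx hy
  | smul c x _ hx => exact smul c x hx

theorem bivectorEval_map (L : V →ₗ[ℝ] W) (r : ⋀[ℝ]^2 V) (α β : Module.Dual ℝ W) :
    bivectorEval (exteriorPower.map 2 L r) α β = bivectorEval r (α ∘ₗ L) (β ∘ₗ L) := by
  induction r using bivector_induction with
  | wedge v w =>
    have : L ∘ ![v, w] = ![L v, L w] := by ext i; fin_cases i <;> rfl
    rw [exteriorPower.map_apply_ιMulti, this, bivectorEval_ιMulti, bivectorEval_ιMulti]
    rfl
  | zero => rw [map_zero, bivectorEval_zero, bivectorEval_zero]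
  | add r s hr hs => rw [map_add, bivectorEval_add, hr, hs, bivectorEval_add]
  | smul c r hr => rw [map_smul, bivectorEval_smul, hr, bivectorEval_smul]

theorem bivector_map_comp_apply {U : Type*} [AddCommGroup U] [Module ℝ U] (g : W →ₗ[ℝ] U)
    (f : V →ₗ[ℝ] W) (r : ⋀[ℝ]^2 V) :
    exteriorPower.map 2 (g ∘ₗ f) r = exteriorPower.map 2 g (exteriorPower.map 2 f r) := by
  rw [← LinearMap.comp_apply, exteriorPower.map_comp]

theorem bivectorEval_swap (r : ⋀[ℝ]^2 V) (α β : Module.Dual ℝ V) :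
    bivectorEval r β α = - bivectorEval r α β := by
  induction r using bivector_induction with
  | wedge v w => rw [bivectorEval_ιMulti, bivectorEval_ιMulti]; ring
  | zero => simp only [bivectorEval_zero, neg_zero]
  | add r s hr hs => rw [bivectorEval_add, hr, hs, bivectorEval_add]; ring
  | smul c r hr => rw [bivectorEval_smul, hr, bivectorEval_smul]; ring

theorem bivectorEval_eq_sum {ι : Type*} [Fintype ι] (b : Module.Basis ι ℝ V) (r : ⋀[ℝ]^2 V)
    (α β : Module.Dual ℝ V) :
    bivectorEval r α β =
      ∑ i, ∑ j, bivectorEval r (b.coord i) (b.coord j) * α (b i) * β (b j) := by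
  have expand : ∀ (α : Module.Dual ℝ V) (v : V), α v = ∑ i, b.repr v i * α (b i) := by
    intro α v
    conv_lhs => rw [← b.sum_repr v, map_sum]
    simp only [map_smul, smul_eq_mul]
  induction r using bivector_induction with
  | wedge v w =>
    simp only [bivectorEval_ιMulti, Module.Basis.coord_apply]
    rw [expand α v, expand β w, expand α w, expand β v, Finset.sum_mul_sum, Finset.sum_mul_sum,
      ← Finset.sum_sub_distrib]
    refine Finset.sum_congr rfl fun i _ ↦ ?_
    rw [← Finset.sum_sub_distrib]
    refine Finset.sum_congr rfl fun j _ ↦ ?_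
    ring
  | zero => simp [bivectorEval_zero]
  | add r s hr hs => simp only [bivectorEval_add, hr, hs, add_mul, Finset.sum_add_distrib]
  | smul c r hr => simp only [bivectorEval_smul, hr, mul_assoc, Finset.mul_sum]

/-- The cyclic sum over `(a, b, c)` of
`∑ Rₖₗ Rᵢⱼ (a(Dₖᵢ) b(Aⱼ) + a(Aᵢ) b(Dₖⱼ)) c(Aₗ)` vanishes if `R` is skew and `D` is symmetric. -/
theorem cyclic_sum_eq_zero {ι : Type*} [Fintype ι] (R : ι → ι → ℝ)
    (hR : ∀ i j, R j i = - R i j) (D : ι → ι → V) (hD : ∀ i j, D i j = D j i) (A : ι → V)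
    (a b c : Module.Dual ℝ V) :
    let T : Module.Dual ℝ V → Module.Dual ℝ V → Module.Dual ℝ V → ℝ := fun a b c ↦
      ∑ k, ∑ l, R k l * (∑ i, ∑ j, R i j * (a (D k i) * b (A j) + a (A i) * b (D k j))) * c (A l)
    T a b c + T b c a + T c a b = 0 := by
  intro T
  let ρ : Module.Dual ℝ V → ι → ℝ := fun a i ↦ ∑ j, R i j * a (A j)
  -- Skewness of `R` gives `T a b c = X a b c - X b a c`, and symmetry of `D` makes `X` symmetric in
  -- its last two arguments. The six terms of the cyclic sum then cancel in pairs.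
  let X : Module.Dual ℝ V → Module.Dual ℝ V → Module.Dual ℝ V → ℝ := fun a b c ↦
    ∑ k, ∑ i, a (D k i) * ρ b i * ρ c k
  have hρ : ∀ a j, ∑ i, R i j * a (A i) = - ρ a j := by
    intro a j
    simp only [ρ, ← Finset.sum_neg_distrib]
    refine Finset.sum_congr rfl fun i _ ↦ ?_
    rw [hR j i]; ring
  have hT : ∀ a b c, T a b c = X a b c - X b a c := by
    intro a b c
    have h1 : ∀ k, ∑ i, ∑ j, R i j * (a (D k i) * b (A j) + a (A i) * b (D k j)) =
        ∑ i, a (D k i) * ρ b i - ∑ i, b (D k i) * ρ a i := by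
      intro k
      simp only [mul_add, Finset.sum_add_distrib, sub_eq_add_neg, ← Finset.sum_neg_distrib]
      congr 1
      · refine Finset.sum_congr rfl fun i _ ↦ ?_
        simp only [ρ, Finset.mul_sum]
        refine Finset.sum_congr rfl fun j _ ↦ ?_
        ring
      · rw [Finset.sum_comm]
        refine Finset.sum_congr rfl fun j _ ↦ ?_
        rw [← mul_neg, ← hρ, Finset.mul_sum]
        refine Finset.sum_congr rfl fun i _ ↦ ?_
        ring
    simp only [T, X, h1, ← Finset.sum_sub_distrib]
    refine Finset.sum_congr rfl fun k _ ↦ ?_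
    have hS : ∀ S : ℝ, ∑ l, R k l * S * c (A l) = S * ρ c k := by
      intro S
      simp only [ρ, Finset.mul_sum]
      exact Finset.sum_congr rfl fun l _ ↦ by ring
    rw [hS, Finset.sum_mul]
    exact Finset.sum_congr rfl fun i _ ↦ sub_mul _ _ _
  have hX : ∀ a b c, X a b c = X a c b := by
    intro a b c
    simp only [X]
    rw [Finset.sum_comm]
    refine Finset.sum_congr rfl fun k _ ↦ Finset.sum_congr rfl fun i _ ↦ ?_
    rw [hD]; ring
  rw [hT, hT, hT, hX a b c, hX b a c, hX c b a]
  ring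

end BivectorAlgebra

/-! ### Lie brackets as commutators of derivations. -/

section Commutator

open VectorField
open scoped Topology

variable {E : Type*} [NormedAddCommGroup E] [NormedSpace ℝ E]
  {F : Type*} [NormedAddCommGroup F] [NormedSpace ℝ F]
  {M : Type*} [TopologicalSpace M] [ChartedSpace E M] [IsManifold 𝓘(ℝ, E) 2 M]

/-- The derivative of a vector-valued function along a vector field. -/
def derivAlong (V : ∀ x : M, TangentSpace 𝓘(ℝ, E) x) (f : M → F) (x : M) : F :=
  mfderiv 𝓘(ℝ, E) 𝓘(ℝ, F) f x (V x)

/-- The right-hand side is the coordinate expression of `V` that enters the definition of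
`mlieBracket`; this lets the commutator be computed by ordinary calculus in the chart. -/
theorem mfderiv_extChartAt_apply_eventually (V : ∀ x : M, TangentSpace 𝓘(ℝ, E) x) (x₀ : M) :
    ∀ᶠ x in 𝓝 x₀, (mfderiv 𝓘(ℝ, E) 𝓘(ℝ, E) (extChartAt 𝓘(ℝ, E) x₀) x (V x) : E) =
      mpullbackWithin 𝓘(ℝ, E) 𝓘(ℝ, E) (extChartAt 𝓘(ℝ, E) x₀).symm V (Set.range 𝓘(ℝ, E))
        (extChartAt 𝓘(ℝ, E) x₀ x) := by
  have : IsManifold 𝓘(ℝ, E) 1 M := IsManifold.of_le (n := 2) (by norm_num)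
  have h := eventuallyEq_mpullback_mpullbackWithin_extChartAt (I := 𝓘(ℝ, E)) (s := Set.univ)
    (x := x₀) V
  rw [nhdsWithin_univ] at h
  filter_upwards [h, extChartAt_source_mem_nhds (I := 𝓘(ℝ, E)) x₀] with x hx hs
  rw [hx, mpullback_apply]
  exact (isInvertible_mfderiv_extChartAt hs).self_apply_inverse _

theorem derivAlong_eventuallyEq_comp_extChartAt (V : ∀ x : M, TangentSpace 𝓘(ℝ, E) x)
    {f : M → F} {x₀ : M} (hf : ContMDiffAt 𝓘(ℝ, E) 𝓘(ℝ, F) 2 f x₀) :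
    derivAlong V f =ᶠ[𝓝 x₀] fun x ↦
      fderiv ℝ (f ∘ (extChartAt 𝓘(ℝ, E) x₀).symm) (extChartAt 𝓘(ℝ, E) x₀ x)
        (mpullbackWithin 𝓘(ℝ, E) 𝓘(ℝ, E) (extChartAt 𝓘(ℝ, E) x₀).symm V (Set.range 𝓘(ℝ, E))
          (extChartAt 𝓘(ℝ, E) x₀ x)) := by
  have : IsManifold 𝓘(ℝ, E) 1 M := IsManifold.of_le (n := 2) (by norm_num)
  have hd : ∀ᶠ x in 𝓝 x₀, MDifferentiableAt 𝓘(ℝ, E) 𝓘(ℝ, F) f x := by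
    filter_upwards [(contMDiffAt_iff_contMDiffAt_nhds (by simp)).1
      (hf.of_le (m := 1) (by norm_num))] with x hx
    exact hx.mdifferentiableAt (by simp)
  filter_upwards [mfderiv_extChartAt_apply_eventually V x₀, hd,
    extChartAt_source_mem_nhds (I := 𝓘(ℝ, E)) x₀] with x hx hdx hs
  have hc : MDifferentiableAt 𝓘(ℝ, E) 𝓘(ℝ, E) (extChartAt 𝓘(ℝ, E) x₀) x :=
    mdifferentiableAt_extChartAt (by simpa using hs)
  have hy := (extChartAt 𝓘(ℝ, E) x₀).map_source hs
  have hsymm : MDifferentiableAt 𝓘(ℝ, E) 𝓘(ℝ, E) (extChartAt 𝓘(ℝ, E) x₀).symm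
      (extChartAt 𝓘(ℝ, E) x₀ x) := by
    have := mdifferentiableWithinAt_extChartAt_symm (I := 𝓘(ℝ, E)) hy
    rwa [ModelWithCorners.range_eq_univ, mdifferentiableWithinAt_univ] at this
  have hfs : MDifferentiableAt 𝓘(ℝ, E) 𝓘(ℝ, F) (f ∘ (extChartAt 𝓘(ℝ, E) x₀).symm)
      (extChartAt 𝓘(ℝ, E) x₀ x) := by
    refine MDifferentiableAt.comp _ ?_ hsymm
    rwa [(extChartAt 𝓘(ℝ, E) x₀).left_inv hs]
  have heq : f =ᶠ[𝓝 x] (f ∘ (extChartAt 𝓘(ℝ, E) x₀).symm) ∘ extChartAt 𝓘(ℝ, E) x₀ := by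
    filter_upwards [(isOpen_extChartAt_source (I := 𝓘(ℝ, E)) x₀).mem_nhds hs] with z hz
    simp only [Function.comp_apply, (extChartAt 𝓘(ℝ, E) x₀).left_inv hz]
  have hfd := (hfs.hasMFDerivAt.comp x hc.hasMFDerivAt).congr_of_eventuallyEq heq
  rw [mfderiv_eq_fderiv] at hfd
  refine (congrArg (fun L : E →L[ℝ] F ↦ L (V x)) hfd.mfderiv).trans ?_
  exact congrArg (fderiv ℝ (f ∘ (extChartAt 𝓘(ℝ, E) x₀).symm) (extChartAt 𝓘(ℝ, E) x₀ x)) hx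

/-- The commutator of the derivatives along two vector fields is the derivative along their
Lie bracket. -/
theorem derivAlong_commutator [CompleteSpace E] {V W : ∀ x : M, TangentSpace 𝓘(ℝ, E) x} {f : M → F} {x₀ : M}
    (hf : ContMDiffAt 𝓘(ℝ, E) 𝓘(ℝ, F) 2 f x₀)
    (hV : ContMDiffAt 𝓘(ℝ, E) 𝓘(ℝ, E).tangent 1
      (fun x ↦ (⟨x, V x⟩ : TangentBundle 𝓘(ℝ, E) M)) x₀)
    (hW : ContMDiffAt 𝓘(ℝ, E) 𝓘(ℝ, E).tangent 1
      (fun x ↦ (⟨x, W x⟩ : TangentBundle 𝓘(ℝ, E) M)) x₀) :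
    derivAlong V (derivAlong W f) x₀ - derivAlong W (derivAlong V f) x₀ =
      derivAlong (mlieBracket 𝓘(ℝ, E) V W) f x₀ := by
  have : IsManifold 𝓘(ℝ, E) 1 M := IsManifold.of_le (n := 2) (by norm_num)
  set φ := extChartAt 𝓘(ℝ, E) x₀ with hφ
  set y₀ := φ x₀ with hy₀
  set fh : E → F := f ∘ φ.symm with hfh
  let lift : (∀ x : M, TangentSpace 𝓘(ℝ, E) x) → E → E := fun V ↦
    mpullbackWithin 𝓘(ℝ, E) 𝓘(ℝ, E) φ.symm V (Set.range 𝓘(ℝ, E))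
  have hfh2 : ContDiffAt ℝ 2 fh y₀ := by
    have h := hf
    rw [contMDiffAt_iff] at h
    simpa using! h.2
  have hlift : ∀ {V : ∀ x : M, TangentSpace 𝓘(ℝ, E) x},
      ContMDiffAt 𝓘(ℝ, E) 𝓘(ℝ, E).tangent 1
        (fun x ↦ (⟨x, V x⟩ : TangentBundle 𝓘(ℝ, E) M)) x₀ →
      DifferentiableAt ℝ (lift V) y₀ := by
    intro V hV
    have h := contMDiffWithinAt_mpullbackWithin_extChartAt_symm (m := 1) (n := 2)
      (contMDiffWithinAt_univ.2 hV) uniqueMDiffOn_univ (Set.mem_univ _) (by norm_num)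
    rw [Set.preimage_univ, Set.inter_univ] at h
    have h' := h.contMDiffAt (extChartAt_target_mem_nhds (I := 𝓘(ℝ, E)) x₀)
    exact (contMDiffAt_vectorSpace_iff_contDiffAt.1 h').differentiableAt (by simp)
  have hchart : ∀ V : ∀ x : M, TangentSpace 𝓘(ℝ, E) x,
      (mfderiv 𝓘(ℝ, E) 𝓘(ℝ, E) φ x₀ (V x₀) : E) = lift V y₀ :=
    fun V ↦ (mfderiv_extChartAt_apply_eventually V x₀).self_of_nhds
  have hφd : HasMFDerivAt 𝓘(ℝ, E) 𝓘(ℝ, E) φ x₀ (mfderiv 𝓘(ℝ, E) 𝓘(ℝ, E) φ x₀) :=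
    (mdifferentiableAt_extChartAt (mem_chart_source E x₀)).hasMFDerivAt
  have hfd : DifferentiableAt ℝ (fderiv ℝ fh) y₀ :=
    (hfh2.fderiv_right (m := 1) (by norm_num)).differentiableAt (by simp)
  -- The product rule yields a Hessian term, symmetric in `V` and `W`, and a first-order term. Only
  -- the latter survives in the commutator, where it gives the coordinate formula for the bracket.
  have second : ∀ {V W : ∀ x : M, TangentSpace 𝓘(ℝ, E) x}, DifferentiableAt ℝ (lift W) y₀ →
      derivAlong V (derivAlong W f) x₀ =
        fderiv ℝ (fderiv ℝ fh) y₀ (lift V y₀) (lift W y₀) +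
          fderiv ℝ fh y₀ (fderiv ℝ (lift W) y₀ (lift V y₀)) := by
    intro V W hW
    have h1 : HasFDerivAt (fun y ↦ fderiv ℝ fh y (lift W y)) _ y₀ :=
      hfd.hasFDerivAt.clm_apply hW.hasFDerivAt
    have h2 := (HasMFDerivAt.comp x₀ h1.hasMFDerivAt hφd).congr_of_eventuallyEq
      (derivAlong_eventuallyEq_comp_extChartAt W hf)
    refine (congrArg (fun L : E →L[ℝ] F ↦ L (V x₀)) h2.mfderiv).trans ?_
    exact (congrArg (fun z : E ↦ fderiv ℝ fh y₀ (fderiv ℝ (lift W) y₀ z) +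
      fderiv ℝ (fderiv ℝ fh) y₀ z (lift W y₀)) (hchart V)).trans (add_comm _ _)
  rw [second (hlift hW), second (hlift hV),
    (derivAlong_eventuallyEq_comp_extChartAt (mlieBracket 𝓘(ℝ, E) V W) hf).self_of_nhds]
  have hbr : lift (mlieBracket 𝓘(ℝ, E) V W) y₀ =
      fderiv ℝ (lift W) y₀ (lift V y₀) - fderiv ℝ (lift V) y₀ (lift W y₀) := by
    rw [← hchart, ← mlieBracketWithin_univ, mlieBracketWithin_apply]
    refine ((isInvertible_mfderiv_extChartAt
      (mem_extChartAt_source x₀)).self_apply_inverse _).trans ?_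
    have huniv : (extChartAt 𝓘(ℝ, E) x₀).symm ⁻¹' Set.univ ∩ Set.range 𝓘(ℝ, E) = Set.univ := by
      simp
    rw [huniv]
    exact congrFun (lieBracketWithin_univ (V := lift V) (W := lift W)) y₀
  change _ = fderiv ℝ fh y₀ (lift (mlieBracket 𝓘(ℝ, E) V W) y₀)
  have hsymm := hfh2.isSymmSndFDerivAt (by simp) (lift V y₀) (lift W y₀)
  rw [hbr, hsymm, map_sub]
  abel

end Commutator

/-! ### Local sections and fibre curves of submersions. -/

section SubmersionSections

open scoped Topology

variable {E : Type*} [NormedAddCommGroup E] [NormedSpace ℝ E]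
  {F : Type*} [NormedAddCommGroup F] [NormedSpace ℝ F]
  {M : Type*} [TopologicalSpace M] [ChartedSpace E M]
  {N : Type*} [TopologicalSpace N] [ChartedSpace F N]

/-- A smooth submersion has smooth local sections. -/
theorem Manifold.IsSubmersionAt.exists_local_section [IsManifold 𝓘(ℝ, E) ∞ M]
    [IsManifold 𝓘(ℝ, F) ∞ N] {p : M → N} {x₀ : M}
    (hp : Manifold.IsSubmersionAt 𝓘(ℝ, E) 𝓘(ℝ, F) ∞ p x₀) :
    ∃ s : N → M, ContMDiffAt 𝓘(ℝ, F) 𝓘(ℝ, E) ∞ s (p x₀) ∧ s (p x₀) = x₀ ∧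
      ∀ᶠ y in 𝓝 (p x₀), p (s y) = y := by
  set ψ := hp.domChart with hψ
  set χ := hp.codChart with hχ
  let e := hp.equiv
  have hx : x₀ ∈ ψ.source := hp.mem_domChart_source
  have hy : p x₀ ∈ χ.source := hp.mem_codChart_source
  have hsub : ψ.source ⊆ p ⁻¹' χ.source := hp.source_subset_preimage_source
  have hw : ∀ z ∈ ψ.target, χ (p (ψ.symm z)) = (e z).1 := by
    intro z hz
    have := hp.writtenInCharts (show z ∈ (hp.domChart.extend 𝓘(ℝ, E)).target by simpa using hz)
    simpa using! this
  -- In adapted charts `p` is the projection to the first factor; the section freezes the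
  -- complementary coordinate at its value for `x₀`.
  let σ : N → E := fun y ↦ e.symm (χ y, (e (ψ x₀)).2)
  have hσ₀ : σ (p x₀) = ψ x₀ := by
    have h1 := hw (ψ x₀) (ψ.map_source hx)
    rw [ψ.left_inv hx] at h1
    simp [σ, h1]
  have hσ : ContMDiffAt 𝓘(ℝ, F) 𝓘(ℝ, E) ∞ σ (p x₀) := by
    have h1 : ContMDiffAt 𝓘(ℝ, F) 𝓘(ℝ, F) ∞ χ (p x₀) :=
      contMDiffAt_of_mem_maximalAtlas hp.codChart_mem_maximalAtlas hy
    have h2 : ContDiff ℝ ∞ (fun w : F ↦ e.symm (w, (e (ψ x₀)).2)) :=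
      e.symm.contDiff.comp (contDiff_id.prodMk contDiff_const)
    exact h2.contMDiff.contMDiffAt.comp _ h1
  have hσt : ∀ᶠ y in 𝓝 (p x₀), σ y ∈ ψ.target :=
    hσ.continuousAt (ψ.open_target.mem_nhds (hσ₀ ▸ ψ.map_source hx))
  refine ⟨fun y ↦ ψ.symm (σ y), ?_, ?_, ?_⟩
  · refine ContMDiffAt.comp _ ?_ hσ
    rw [hσ₀]
    exact contMDiffAt_symm_of_mem_maximalAtlas hp.domChart_mem_maximalAtlas (ψ.map_source hx)
  · change ψ.symm (σ (p x₀)) = x₀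
    rw [hσ₀, ψ.left_inv hx]
  · filter_upwards [hσt, χ.open_source.mem_nhds hy] with y hyt hys
    refine χ.injOn (hsub (ψ.map_target hyt)) hys ?_
    rw [hw _ hyt]
    simp [σ]

/-- Every vector in the kernel of the differential of a submersion is the velocity of a smooth
curve in the fibre. -/
theorem Manifold.IsSubmersionAt.exists_curve_in_fiber [IsManifold 𝓘(ℝ, E) ∞ M]
    [IsManifold 𝓘(ℝ, F) ∞ N] {p : M → N} {x₀ : M}
    (hp : Manifold.IsSubmersionAt 𝓘(ℝ, E) 𝓘(ℝ, F) ∞ p x₀) (u : TangentSpace 𝓘(ℝ, E) x₀)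
    (hu : mfderiv 𝓘(ℝ, E) 𝓘(ℝ, F) p x₀ u = 0) :
    ∃ γ : ℝ → M, ContMDiff 𝓘(ℝ, ℝ) 𝓘(ℝ, E) ∞ γ ∧ γ 0 = x₀ ∧ (∀ t, p (γ t) = p x₀) ∧
      (mfderiv 𝓘(ℝ, ℝ) 𝓘(ℝ, E) γ 0 (1 : ℝ) : E) = u := by
  set ψ := hp.domChart with hψ
  set χ := hp.codChart with hχ
  let e := hp.equiv
  have hx : x₀ ∈ ψ.source := hp.mem_domChart_source
  have hy : p x₀ ∈ χ.source := hp.mem_codChart_source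
  have hsub : ψ.source ⊆ p ⁻¹' χ.source := hp.source_subset_preimage_source
  have hw : ∀ z ∈ ψ.target, χ (p (ψ.symm z)) = (e z).1 := by
    intro z hz
    have := hp.writtenInCharts (show z ∈ (hp.domChart.extend 𝓘(ℝ, E)).target by simpa using hz)
    simpa using! this
  have hψd : HasMFDerivAt 𝓘(ℝ, E) 𝓘(ℝ, E) ψ x₀ (mfderiv 𝓘(ℝ, E) 𝓘(ℝ, E) ψ x₀) :=
    ((contMDiffAt_of_mem_maximalAtlas hp.domChart_mem_maximalAtlas hx).mdifferentiableAt
      (by simp)).hasMFDerivAt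
  have hχd : HasMFDerivAt 𝓘(ℝ, F) 𝓘(ℝ, F) χ (p x₀) (mfderiv 𝓘(ℝ, F) 𝓘(ℝ, F) χ (p x₀)) :=
    ((contMDiffAt_of_mem_maximalAtlas hp.codChart_mem_maximalAtlas hy).mdifferentiableAt
      (by simp)).hasMFDerivAt
  have hψs : HasMFDerivAt 𝓘(ℝ, E) 𝓘(ℝ, E) ψ.symm (ψ x₀) (mfderiv 𝓘(ℝ, E) 𝓘(ℝ, E) ψ.symm (ψ x₀)) :=
    ((contMDiffAt_symm_of_mem_maximalAtlas hp.domChart_mem_maximalAtlas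
      (ψ.map_source hx)).mdifferentiableAt (by simp)).hasMFDerivAt
  let z : E := mfderiv 𝓘(ℝ, E) 𝓘(ℝ, E) ψ x₀ u
  -- Moving from `ψ x₀` in the direction `z` changes only the complementary coordinate, so it stays
  -- in the fibre.
  have hz : (e z).1 = 0 := by
    have h1 : HasMFDerivAt 𝓘(ℝ, E) 𝓘(ℝ, F) (χ ∘ p) x₀ _ :=
      hχd.comp x₀ (hp.contMDiffAt.mdifferentiableAt (by simp)).hasMFDerivAt
    let q : E →L[ℝ] F := (ContinuousLinearMap.fst ℝ F hp.complement).comp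
      (e : E →L[ℝ] F × hp.complement)
    have h2 : HasMFDerivAt 𝓘(ℝ, E) 𝓘(ℝ, F) (q ∘ ψ) x₀ _ := q.hasMFDerivAt.comp x₀ hψd
    have h3 : χ ∘ p =ᶠ[𝓝 x₀] q ∘ ψ := by
      filter_upwards [ψ.open_source.mem_nhds hx] with y hy
      have := hw (ψ y) (ψ.map_source hy)
      rw [ψ.left_inv hy] at this
      exact this
    have h4 := hasMFDerivAt_unique (h2.congr_of_eventuallyEq h3) h1
    have h5 := congrArg (fun L : E →L[ℝ] F ↦ L u) h4
    refine h5.trans ?_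
    change mfderiv 𝓘(ℝ, F) 𝓘(ℝ, F) χ (p x₀) (mfderiv 𝓘(ℝ, E) 𝓘(ℝ, F) p x₀ u) = 0
    rw [hu, map_zero]
  obtain ⟨δ, hδ, hball⟩ := Metric.isOpen_iff.1 ψ.open_target (ψ x₀) (ψ.map_source hx)
  obtain ⟨ε, hε, hεδ⟩ : ∃ ε : ℝ, 0 < ε ∧ ε * ‖z‖ < δ := by
    refine ⟨δ / (‖z‖ + 1), by positivity, ?_⟩
    rw [div_mul_eq_mul_div, div_lt_iff₀ (by positivity)]
    nlinarith [norm_nonneg z]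
  -- The curve must be defined on all of `ℝ`. The sine keeps it within `ε‖z‖ < δ` of `ψ x₀`, inside
  -- the chart, and the factor `ε⁻¹` restores the velocity `z` at `0`.
  let c : ℝ → E := fun t ↦ ψ x₀ + (ε * Real.sin (ε⁻¹ * t)) • z
  have hc0 : c 0 = ψ x₀ := by simp [c]
  have hct : ∀ t, c t ∈ ψ.target := by
    intro t
    apply hball
    rw [Metric.mem_ball, dist_eq_norm, add_sub_cancel_left, norm_smul, norm_mul,
      Real.norm_of_nonneg hε.le]
    refine lt_of_le_of_lt ?_ hεδ
    have := Real.abs_sin_le_one (ε⁻¹ * t)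
    rw [← Real.norm_eq_abs] at this
    gcongr
    nlinarith
  have hcs : ContDiff ℝ ∞ c :=
    contDiff_const.add (((contDiff_const.mul (Real.contDiff_sin.comp
      (contDiff_const.mul contDiff_id))).smul contDiff_const))
  have hcd : HasDerivAt c z 0 := by
    have h1 : HasDerivAt (fun t : ℝ ↦ ε⁻¹ * t) ε⁻¹ 0 := by
      simpa using (hasDerivAt_id (0 : ℝ)).const_mul ε⁻¹
    have h2 := ((h1.sin.const_mul ε).smul_const z).const_add (ψ x₀)
    have h3 : (ε * (Real.cos (ε⁻¹ * 0) * ε⁻¹)) • z = z := by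
      rw [mul_zero, Real.cos_zero, one_mul, mul_inv_cancel₀ hε.ne', one_smul]
    rwa [h3] at h2
  refine ⟨fun t ↦ ψ.symm (c t), ?_, ?_, ?_, ?_⟩
  · intro t
    exact (contMDiffAt_symm_of_mem_maximalAtlas hp.domChart_mem_maximalAtlas (hct t)).comp t
      hcs.contMDiff.contMDiffAt
  · change ψ.symm (c 0) = x₀
    rw [hc0, ψ.left_inv hx]
  · intro t
    refine χ.injOn (hsub (ψ.map_target (hct t))) hy ?_
    have h1 := hw (ψ x₀) (ψ.map_source hx)
    rw [ψ.left_inv hx] at h1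
    rw [hw _ (hct t), h1]
    simp [c, hz]
  · have h1 : HasMFDerivAt 𝓘(ℝ, E) 𝓘(ℝ, E) ψ.symm (c 0) (mfderiv 𝓘(ℝ, E) 𝓘(ℝ, E) ψ.symm (ψ x₀)) := by
      rw [hc0]; exact hψs
    have h2 := (h1.comp (0 : ℝ) hcd.hasFDerivAt.hasMFDerivAt).mfderiv
    refine (congrArg (fun L : ℝ →L[ℝ] E ↦ L 1) h2).trans ?_
    change (mfderiv 𝓘(ℝ, E) 𝓘(ℝ, E) ψ.symm (ψ x₀) ((1 : ℝ) • z) : E) = u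
    rw [one_smul]
    have h3 := hψs.comp x₀ hψd
    have h4 : ψ.symm ∘ ψ =ᶠ[𝓝 x₀] id := by
      filter_upwards [ψ.open_source.mem_nhds hx] with y hy
      exact ψ.left_inv hy
    have h5 := hasMFDerivAt_unique h3 ((hasMFDerivAt_id x₀).congr_of_eventuallyEq h4)
    exact congrArg (fun L : E →L[ℝ] E ↦ L u) h5

end SubmersionSections

/-! ### Translations, isotropy and the tangent space of the quotient. -/

section HomogeneousSpace

open scoped Topology

variable {E : Type*} [NormedAddCommGroup E] [NormedSpace ℝ E]
  {G : Type*} [TopologicalSpace G] [ChartedSpace E G] [Group G] [LieGroup 𝓘(ℝ, E) ∞ G]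
  {H : Subgroup G}
  {F : Type*} [NormedAddCommGroup F] [NormedSpace ℝ F]
  [ChartedSpace F (G ⧸ H)] [IsManifold 𝓘(ℝ, F) ∞ (G ⧸ H)]

/-- Locally `λ_g = p ∘ L_g ∘ s` for a smooth local section `s` of `p`, with `L_g` left
multiplication on `G`. -/
theorem contMDiff_smul_quotient
    (hp : Manifold.IsSubmersion 𝓘(ℝ, E) 𝓘(ℝ, F) ∞ (fun a : G ↦ (a : G ⧸ H))) (g : G) :
    ContMDiff 𝓘(ℝ, F) 𝓘(ℝ, F) ∞ (fun x : G ⧸ H ↦ g • x) := by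
  intro x
  obtain ⟨a, rfl⟩ := QuotientGroup.mk_surjective x
  obtain ⟨s, hs, hsa, hps⟩ := (hp.isSubmersionAt a).exists_local_section
  have h1 : ContMDiffAt 𝓘(ℝ, F) 𝓘(ℝ, F) ∞ (fun x : G ⧸ H ↦ ((g * s x : G) : G ⧸ H)) a :=
    hp.contMDiff.contMDiffAt.comp _ (contMDiff_mul_left.contMDiffAt.comp (g := (g * ·)) _ hs)
  refine h1.congr_of_eventuallyEq ?_
  filter_upwards [hps] with y hy
  conv_lhs => rw [← hy]
  rfl

theorem hasMFDerivAt_smul_quotient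
    (hp : Manifold.IsSubmersion 𝓘(ℝ, E) 𝓘(ℝ, F) ∞ (fun a : G ↦ (a : G ⧸ H))) (g : G) (x : G ⧸ H) :
    HasMFDerivAt 𝓘(ℝ, F) 𝓘(ℝ, F) (fun x : G ⧸ H ↦ g • x) x
      (mfderiv 𝓘(ℝ, F) 𝓘(ℝ, F) (fun x : G ⧸ H ↦ g • x) x) :=
  ((contMDiff_smul_quotient hp g).mdifferentiableAt (by simp)).hasMFDerivAt

omit [LieGroup 𝓘(ℝ, E) ∞ G] [IsManifold 𝓘(ℝ, F) ∞ (G ⧸ H)] in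
theorem hasMFDerivAt_quotientMk
    (hp : Manifold.IsSubmersion 𝓘(ℝ, E) 𝓘(ℝ, F) ∞ (fun a : G ↦ (a : G ⧸ H))) (a : G) :
    HasMFDerivAt 𝓘(ℝ, E) 𝓘(ℝ, F) (fun a : G ↦ (a : G ⧸ H)) a
      (mfderiv 𝓘(ℝ, E) 𝓘(ℝ, F) (fun a : G ↦ (a : G ⧸ H)) a) :=
  (hp.contMDiff.mdifferentiableAt (by simp)).hasMFDerivAt

theorem hasMFDerivAt_mul_left_one (g : G) :
    HasMFDerivAt 𝓘(ℝ, E) 𝓘(ℝ, E) (g * ·) (1 : G)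
      (mfderiv 𝓘(ℝ, E) 𝓘(ℝ, E) (g * ·) (1 : G)) :=
  ((contMDiff_mul_left (n := ∞)).mdifferentiableAt (by simp)).hasMFDerivAt

/-- The linear map `translateToQuotient`, with values in the model space. -/
def translateToModel (F : Type*) [NormedAddCommGroup F] [NormedSpace ℝ F]
    [ChartedSpace F (G ⧸ H)] (m : Submodule ℝ (GroupLieAlgebra 𝓘(ℝ, E) G)) (g : G) :
    m →ₗ[ℝ] F :=
  translateToQuotient (H := H) F m g

/-- The linear map `translateToQuotient`, with values in the tangent space at `x`
(meaningful if `x = gH`). -/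
def translateToTangent (F : Type*) [NormedAddCommGroup F] [NormedSpace ℝ F]
    [ChartedSpace F (G ⧸ H)] (m : Submodule ℝ (GroupLieAlgebra 𝓘(ℝ, E) G)) (g : G) (x : G ⧸ H) :
    m →ₗ[ℝ] TangentSpace 𝓘(ℝ, F) x :=
  translateToModel (H := H) F m g

/-- The differential at `1` of the projection `G → G ⧸ H`, restricted to `m`. -/
def projTangent (F : Type*) [NormedAddCommGroup F] [NormedSpace ℝ F]
    [ChartedSpace F (G ⧸ H)] (m : Submodule ℝ (GroupLieAlgebra 𝓘(ℝ, E) G)) :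
    m →ₗ[ℝ] F :=
  (mfderiv 𝓘(ℝ, E) 𝓘(ℝ, F) (fun a : G ↦ (a : G ⧸ H)) 1).toLinearMap ∘ₗ m.subtype

variable (m : Submodule ℝ (GroupLieAlgebra 𝓘(ℝ, E) G))

/-- Differentiate `λ_g ∘ p = p ∘ L_g` at `1`. This links the bivector field to left-invariant vector
fields on `G`. -/
theorem translateToModel_apply
    (hp : Manifold.IsSubmersion 𝓘(ℝ, E) 𝓘(ℝ, F) ∞ (fun a : G ↦ (a : G ⧸ H))) (g : G) (u : m) :
    translateToModel (H := H) F m g u = mfderiv 𝓘(ℝ, E) 𝓘(ℝ, F) (fun a : G ↦ (a : G ⧸ H)) g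
      (mulInvariantVectorField (u : GroupLieAlgebra 𝓘(ℝ, E) G) g) := by
  have h1 := (hasMFDerivAt_smul_quotient hp g ((1 : G) : G ⧸ H)).comp (1 : G)
    (hasMFDerivAt_quotientMk hp 1)
  have h2 : HasMFDerivAt 𝓘(ℝ, E) 𝓘(ℝ, F) (fun a : G ↦ (a : G ⧸ H)) (g * 1)
      (mfderiv 𝓘(ℝ, E) 𝓘(ℝ, F) (fun a : G ↦ (a : G ⧸ H)) g) := by
    rw [mul_one]; exact hasMFDerivAt_quotientMk hp g
  have h3 := HasMFDerivAt.comp (1 : G) h2 (hasMFDerivAt_mul_left_one g)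
  exact congrArg (fun L : E →L[ℝ] F ↦ L (m.subtype u)) (hasMFDerivAt_unique h1 h3)

theorem translateToModel_mul
    (hp : Manifold.IsSubmersion 𝓘(ℝ, E) 𝓘(ℝ, F) ∞ (fun a : G ↦ (a : G ⧸ H))) (g a : G) :
    translateToModel (H := H) F m (g * a) =
      (mfderiv 𝓘(ℝ, F) 𝓘(ℝ, F) (fun x : G ⧸ H ↦ g • x) (a : G ⧸ H)).toLinearMap ∘ₗ
        translateToModel (H := H) F m a := by
  have h1 : HasMFDerivAt 𝓘(ℝ, F) 𝓘(ℝ, F) (fun x : G ⧸ H ↦ g • x) (a • ((1 : G) : G ⧸ H))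
      (mfderiv 𝓘(ℝ, F) 𝓘(ℝ, F) (fun x : G ⧸ H ↦ g • x) (a : G ⧸ H)) := by
    have : a • ((1 : G) : G ⧸ H) = (a : G ⧸ H) := by
      change ((a * 1 : G) : G ⧸ H) = a
      rw [mul_one]
    rw [this]; exact hasMFDerivAt_smul_quotient hp g _
  have h2 := HasMFDerivAt.comp ((1 : G) : G ⧸ H) h1
    (hasMFDerivAt_smul_quotient hp a ((1 : G) : G ⧸ H))
  have h3 : (fun x : G ⧸ H ↦ (g * a) • x) = (fun x : G ⧸ H ↦ g • x) ∘ fun x : G ⧸ H ↦ a • x := by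
    ext x; exact mul_smul g a x
  have h4 := hasMFDerivAt_smul_quotient hp (g * a) ((1 : G) : G ⧸ H)
  rw [h3] at h4
  have h5 := hasMFDerivAt_unique h4 h2
  rw [← h3] at h5
  ext u
  exact congrArg (fun L : F →L[ℝ] F ↦ L (projTangent (H := H) F m u)) h5

/-- Since `x⁻¹` is absorbed on the right only for elements of `H`, one uses `g(axa⁻¹)H = gaxH` for
`a ∈ H` and differentiates at `x = 1`. This is what makes `π^r` independent of representatives. -/
theorem translateToModel_mul_mem
    (hp : Manifold.IsSubmersion 𝓘(ℝ, E) 𝓘(ℝ, F) ∞ (fun a : G ↦ (a : G ⧸ H)))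
    {m : Submodule ℝ (GroupLieAlgebra 𝓘(ℝ, E) G)} (hm : IsSymmetricDecomposition H m)
    (g : G) (a : H) :
    translateToModel (H := H) F m (g * a) =
      translateToModel (H := H) F m g ∘ₗ hm.groupAdRestrict a := by
  have hc : HasMFDerivAt 𝓘(ℝ, E) 𝓘(ℝ, E) (fun x : G ↦ (a : G) * x * (a : G)⁻¹) 1
      (groupAd (E := E) (a : G)) := by
    have : ContMDiff 𝓘(ℝ, E) 𝓘(ℝ, E) ∞ (fun x : G ↦ (a : G) * x * (a : G)⁻¹) :=
      (contMDiff_const.mul contMDiff_id).mul contMDiff_const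
    exact (this.mdifferentiableAt (by simp)).hasMFDerivAt
  have hq : HasMFDerivAt 𝓘(ℝ, E) 𝓘(ℝ, F) (fun a : G ↦ (a : G ⧸ H)) ((a : G) * 1 * (a : G)⁻¹)
      (mfderiv 𝓘(ℝ, E) 𝓘(ℝ, F) (fun a : G ↦ (a : G ⧸ H)) 1) := by
    have : (a : G) * 1 * (a : G)⁻¹ = 1 := by group
    rw [this]; exact hasMFDerivAt_quotientMk hp 1
  have hl : HasMFDerivAt 𝓘(ℝ, F) 𝓘(ℝ, F) (fun x : G ⧸ H ↦ g • x)
      (((a : G) * 1 * (a : G)⁻¹ : G) : G ⧸ H)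
      (mfderiv 𝓘(ℝ, F) 𝓘(ℝ, F) (fun x : G ⧸ H ↦ g • x) ((1 : G) : G ⧸ H)) := by
    have : (a : G) * 1 * (a : G)⁻¹ = 1 := by group
    rw [this]; exact hasMFDerivAt_smul_quotient hp g _
  have h1 := HasMFDerivAt.comp (1 : G) hl (HasMFDerivAt.comp (1 : G) hq hc)
  have h2 := HasMFDerivAt.comp (1 : G)
    (hasMFDerivAt_smul_quotient hp (g * a) ((1 : G) : G ⧸ H)) (hasMFDerivAt_quotientMk hp 1)
  have h3 : (fun x : G ⧸ H ↦ g • x) ∘ (fun a : G ↦ (a : G ⧸ H)) ∘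
      (fun x : G ↦ (a : G) * x * (a : G)⁻¹) =
      (fun x : G ⧸ H ↦ (g * (a : G)) • x) ∘ (fun a : G ↦ (a : G ⧸ H)) := by
    ext x
    change ((g * ((a : G) * x * (a : G)⁻¹) : G) : G ⧸ H) = ((g * a * x : G) : G ⧸ H)
    rw [QuotientGroup.eq]
    convert a.2 using 1
    group
  have h4 := hasMFDerivAt_unique (h2.congr_of_eventuallyEq (.of_eq h3)) h1
  ext u
  exact congrArg (fun L : E →L[ℝ] F ↦ L (m.subtype u)) h4

/-- A curve in `H` has constant projection. Conversely, a kernel vector is the velocity of a curve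
in the fibre over `ē`, and that fibre is `H`. -/
theorem mem_subgroupLieAlgebra_iff
    (hp : Manifold.IsSubmersion 𝓘(ℝ, E) 𝓘(ℝ, F) ∞ (fun a : G ↦ (a : G ⧸ H)))
    (u : GroupLieAlgebra 𝓘(ℝ, E) G) :
    u ∈ subgroupLieAlgebra H ↔
      mfderiv 𝓘(ℝ, E) 𝓘(ℝ, F) (fun a : G ↦ (a : G ⧸ H)) 1 u = 0 := by
  constructor
  · rintro ⟨γ, hγ, h1, hH, rfl⟩
    have hq : HasMFDerivAt 𝓘(ℝ, E) 𝓘(ℝ, F) (fun a : G ↦ (a : G ⧸ H)) (γ 0)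
        (mfderiv 𝓘(ℝ, E) 𝓘(ℝ, F) (fun a : G ↦ (a : G ⧸ H)) 1) := by
      rw [h1]; exact hasMFDerivAt_quotientMk hp 1
    have h2 := HasMFDerivAt.comp (0 : ℝ) hq (hγ.mdifferentiableAt (by simp)).hasMFDerivAt
    have h3 : (fun a : G ↦ (a : G ⧸ H)) ∘ γ = fun _ ↦ ((1 : G) : G ⧸ H) := by
      ext t
      exact QuotientGroup.eq.2 (H.mul_mem (H.inv_mem (hH t)) H.one_mem)
    rw [h3] at h2
    exact congrArg (fun L : ℝ →L[ℝ] F ↦ L 1)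
      (hasMFDerivAt_unique h2 (hasMFDerivAt_const ((1 : G) : G ⧸ H) (0 : ℝ)))
  · intro hu
    obtain ⟨γ, hγ, h0, hpγ, hd⟩ := (hp.isSubmersionAt 1).exists_curve_in_fiber u hu
    refine ⟨γ, hγ, h0, fun t ↦ ?_, hd⟩
    have := QuotientGroup.eq.1 (hpγ t).symm
    simpa using this

/-- Differentiate `p ∘ s = id` for a local section `s` through `1`. -/
theorem mfderiv_quotientMk_surjective
    (hp : Manifold.IsSubmersion 𝓘(ℝ, E) 𝓘(ℝ, F) ∞ (fun a : G ↦ (a : G ⧸ H))) (w : F) :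
    ∃ u : GroupLieAlgebra 𝓘(ℝ, E) G,
      (mfderiv 𝓘(ℝ, E) 𝓘(ℝ, F) (fun a : G ↦ (a : G ⧸ H)) 1 u : F) = w := by
  obtain ⟨s, hs, hs1, hps⟩ := (hp.isSubmersionAt 1).exists_local_section
  have hq : HasMFDerivAt 𝓘(ℝ, E) 𝓘(ℝ, F) (fun a : G ↦ (a : G ⧸ H)) (s ((1 : G) : G ⧸ H))
      (mfderiv 𝓘(ℝ, E) 𝓘(ℝ, F) (fun a : G ↦ (a : G ⧸ H)) 1) := by
    rw [hs1]; exact hasMFDerivAt_quotientMk hp 1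
  have h1 := HasMFDerivAt.comp ((1 : G) : G ⧸ H) hq (hs.mdifferentiableAt (by simp)).hasMFDerivAt
  have h2 := hasMFDerivAt_unique h1 ((hasMFDerivAt_id ((1 : G) : G ⧸ H)).congr_of_eventuallyEq hps)
  exact ⟨mfderiv 𝓘(ℝ, F) 𝓘(ℝ, E) s ((1 : G) : G ⧸ H) w, congrArg (fun L : F →L[ℝ] F ↦ L w) h2⟩

theorem projTangent_bijective
    (hp : Manifold.IsSubmersion 𝓘(ℝ, E) 𝓘(ℝ, F) ∞ (fun a : G ↦ (a : G ⧸ H)))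
    {m : Submodule ℝ (GroupLieAlgebra 𝓘(ℝ, E) G)} (hm : IsSymmetricDecomposition H m) :
    Function.Bijective (projTangent (H := H) F m) := by
  constructor
  · rw [← LinearMap.ker_eq_bot, LinearMap.ker_eq_bot']
    intro u hu
    have h1 : (u : GroupLieAlgebra 𝓘(ℝ, E) G) ∈ subgroupLieAlgebra H :=
      (mem_subgroupLieAlgebra_iff hp _).2 hu
    exact Subtype.ext (Submodule.disjoint_def.1 hm.isCompl.disjoint _ h1 u.2)
  · intro w
    obtain ⟨u, hu⟩ := mfderiv_quotientMk_surjective hp w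
    obtain ⟨x, hx, y, hy, rfl⟩ := Submodule.mem_sup.1
      ((hm.isCompl.sup_eq_top.symm ▸ Submodule.mem_top : u ∈ subgroupLieAlgebra H ⊔ m))
    refine ⟨⟨y, hy⟩, ?_⟩
    have hx0 := (mem_subgroupLieAlgebra_iff hp x).1 hx
    rw [map_add, hx0, zero_add] at hu
    exact hu

theorem translateToModel_one
    (hp : Manifold.IsSubmersion 𝓘(ℝ, E) 𝓘(ℝ, F) ∞ (fun a : G ↦ (a : G ⧸ H))) :
    translateToModel (H := H) F m 1 = projTangent (H := H) F m := by
  have h1 : (fun x : G ⧸ H ↦ (1 : G) • x) = id := by ext x; simp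
  have h2 := hasMFDerivAt_smul_quotient hp 1 ((1 : G) : G ⧸ H)
  have h3 := h2
  rw [h1] at h3
  have h4 := hasMFDerivAt_unique h3 (hasMFDerivAt_id ((1 : G) : G ⧸ H))
  rw [← h1] at h4
  ext u
  exact congrArg (fun L : F →L[ℝ] F ↦ L (projTangent (H := H) F m u)) h4

end HomogeneousSpace

/-! ### Derivatives along left-invariant vector fields. -/

section LeftInvariantDerivative

open scoped Topology
open VectorField

variable {E : Type*} [NormedAddCommGroup E] [NormedSpace ℝ E]
  {G : Type*} [TopologicalSpace G] [ChartedSpace E G] [Group G] [LieGroup 𝓘(ℝ, E) ∞ G]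
  {F : Type*} [NormedAddCommGroup F] [NormedSpace ℝ F]

/-- Differentiation now takes place at the fixed point `1`, with `g` as a parameter; smoothness in
`g` thus becomes smooth dependence of a derivative on a parameter. -/
theorem derivAlong_mulInvariantVectorField {h : G → F} {g : G}
    (hh : MDifferentiableAt 𝓘(ℝ, E) 𝓘(ℝ, F) h g) (u : GroupLieAlgebra 𝓘(ℝ, E) G) :
    derivAlong (mulInvariantVectorField u) h g =
      mfderiv 𝓘(ℝ, E) 𝓘(ℝ, F) (fun x ↦ h (g * x)) (1 : G) u := by
  have h1 : HasMFDerivAt 𝓘(ℝ, E) 𝓘(ℝ, F) h (g * 1) (mfderiv 𝓘(ℝ, E) 𝓘(ℝ, F) h g) := by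
    rw [mul_one]; exact hh.hasMFDerivAt
  have h2 := HasMFDerivAt.comp (1 : G) h1 (hasMFDerivAt_mul_left_one g)
  exact (congrArg (fun L : E →L[ℝ] F ↦ L u) h2.mfderiv).symm

/-- Derivatives of smooth functions along left-invariant vector fields are smooth. -/
theorem ContMDiffAt.derivAlong_mulInvariantVectorField {h : G → F} {g₀ : G}
    (hh : ContMDiffAt 𝓘(ℝ, E) 𝓘(ℝ, F) ∞ h g₀) (u : GroupLieAlgebra 𝓘(ℝ, E) G) :
    ContMDiffAt 𝓘(ℝ, E) 𝓘(ℝ, F) ∞ (derivAlong (mulInvariantVectorField u) h) g₀ := by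
  have hsm : ContMDiffAt (𝓘(ℝ, E).prod 𝓘(ℝ, E)) 𝓘(ℝ, F) ∞
      (Function.uncurry fun g x : G ↦ h (g * x)) (g₀, (1 : G)) := by
    refine ContMDiffAt.comp (g := h) (f := fun z : G × G ↦ z.1 * z.2) (g₀, (1 : G)) ?_
      (contMDiff_mul 𝓘(ℝ, E) ∞).contMDiffAt
    simpa using hh
  have h1 := (ContMDiffAt.mfderiv (m := ∞) (x₀ := g₀) (fun g x : G ↦ h (g * x)) (fun _ ↦ (1 : G))
    hsm contMDiffAt_const (by simp)).clm_apply (contMDiffAt_const (M' := E) (c := u))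
  refine h1.congr_of_eventuallyEq ?_
  have hev : ∀ᶠ g in 𝓝 g₀, ContMDiffAt 𝓘(ℝ, E) 𝓘(ℝ, F) 1 h g :=
    (contMDiffAt_iff_contMDiffAt_nhds (by simp)).1 (hh.of_le (by simp))
  filter_upwards [hev] with g hg
  -- Both coordinate changes are identities: the base point is constantly `1`, the centre of its
  -- chart, and the target is a vector space.
  have key : inTangentCoordinates 𝓘(ℝ, E) 𝓘(ℝ, F) (fun _ ↦ (1 : G)) (fun g ↦ h (g * 1))
      (fun g ↦ mfderiv 𝓘(ℝ, E) 𝓘(ℝ, F) (fun x : G ↦ h (g * x)) 1) g₀ g =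
      mfderiv 𝓘(ℝ, E) 𝓘(ℝ, F) (fun x : G ↦ h (g * x)) 1 := by
    refine (inTangentCoordinates_eq_mfderiv_comp (I := 𝓘(ℝ, E)) (I' := 𝓘(ℝ, F))
      (f := fun _ : G ↦ (1 : G)) (g := fun g : G ↦ h (g * 1)) (x₀ := g₀) (x := g)
      (ϕ := fun g ↦ mfderiv 𝓘(ℝ, E) 𝓘(ℝ, F) (fun x : G ↦ h (g * x)) 1)
      (mem_chart_source E (1 : G)) (by rw [chartAt_self_eq]; trivial)).trans ?_
    have h2 : mfderivWithin 𝓘(ℝ, E) 𝓘(ℝ, E) (extChartAt 𝓘(ℝ, E) (1 : G)).symm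
        (Set.range 𝓘(ℝ, E)) (extChartAt 𝓘(ℝ, E) (1 : G) 1) = ContinuousLinearMap.id ℝ E :=
      mfderivWithin_range_extChartAt_symm
    have h3 : mfderiv 𝓘(ℝ, F) 𝓘(ℝ, F) (extChartAt 𝓘(ℝ, F) (h (g₀ * 1))) (h (g * 1)) =
        ContinuousLinearMap.id ℝ F := by
      rw [extChartAt_model_space_eq_id]
      exact mfderiv_id
    exact congrArg₂ (fun (A : E →L[ℝ] E) (B : F →L[ℝ] F) ↦
      B ∘L (mfderiv 𝓘(ℝ, E) 𝓘(ℝ, F) (fun x : G ↦ h (g * x)) 1 : E →L[ℝ] F) ∘L A) h2 h3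
  refine (_root_.derivAlong_mulInvariantVectorField (hg.mdifferentiableAt (by simp)) u).trans ?_
  exact (congrArg (fun L : E →L[ℝ] F ↦ L u) key).symm

theorem contMDiffAt_mulInvariantVectorField_one (u : GroupLieAlgebra 𝓘(ℝ, E) G) (g : G) :
    ContMDiffAt 𝓘(ℝ, E) 𝓘(ℝ, E).tangent 1
      (fun x ↦ (⟨x, mulInvariantVectorField u x⟩ : TangentBundle 𝓘(ℝ, E) G)) g := by
  have : LieGroup 𝓘(ℝ, E) (minSmoothness ℝ 3) G := by
    rw [minSmoothness_of_isRCLikeNormedField]; infer_instance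
  refine (contMDiffAt_mulInvariantVectorField u).of_le ?_
  rw [minSmoothness_of_isRCLikeNormedField]
  norm_num

/-- The commutator of the derivatives along left-invariant vector fields. -/
theorem derivAlong_mulInvariantVectorField_commutator [CompleteSpace E] {h : G → F} {g : G}
    (hh : ContMDiffAt 𝓘(ℝ, E) 𝓘(ℝ, F) ∞ h g) (u v : GroupLieAlgebra 𝓘(ℝ, E) G) :
    derivAlong (mulInvariantVectorField u) (derivAlong (mulInvariantVectorField v) h) g -
      derivAlong (mulInvariantVectorField v) (derivAlong (mulInvariantVectorField u) h) g =
      derivAlong (mulInvariantVectorField ⁅u, v⁆) h g := by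
  have : LieGroup 𝓘(ℝ, E) (minSmoothness ℝ 3) G := by
    rw [minSmoothness_of_isRCLikeNormedField]; infer_instance
  rw [derivAlong_commutator (hh.of_le ENat.LEInfty.out)
    (contMDiffAt_mulInvariantVectorField_one u g) (contMDiffAt_mulInvariantVectorField_one v g),
    GroupLieAlgebra.bracket_def, mulInvariantVector_mlieBracket]

end LeftInvariantDerivative

/-! ### Chart components of the translated bivector field. -/

section InvariantPoisson

open scoped Topology
open VectorField

variable {E : Type*} [NormedAddCommGroup E] [NormedSpace ℝ E]
  {G : Type*} [TopologicalSpace G] [ChartedSpace E G] [Group G] [LieGroup 𝓘(ℝ, E) ∞ G]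
  {H : Subgroup G}
  {F : Type*} [NormedAddCommGroup F] [NormedSpace ℝ F]
  [ChartedSpace F (G ⧸ H)] [IsManifold 𝓘(ℝ, F) ∞ (G ⧸ H)]
  {m : Submodule ℝ (GroupLieAlgebra 𝓘(ℝ, E) G)}

/-- The derivative along the left-invariant vector field of `u` of the chart at `x₀` of `G ⧸ H`,
pulled back to `G`. -/
def chartDeriv (F : Type*) [NormedAddCommGroup F] [NormedSpace ℝ F]
    [ChartedSpace F (G ⧸ H)] (x₀ : G ⧸ H) (u : GroupLieAlgebra 𝓘(ℝ, E) G) : G → F :=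
  derivAlong (mulInvariantVectorField u) fun a : G ↦ extChartAt 𝓘(ℝ, F) x₀ (a : G ⧸ H)

omit [LieGroup 𝓘(ℝ, E) ∞ G] in
theorem contMDiffAt_extChartAt_quotientMk
    (hp : Manifold.IsSubmersion 𝓘(ℝ, E) 𝓘(ℝ, F) ∞ (fun a : G ↦ (a : G ⧸ H))) {x₀ : G ⧸ H} {g : G}
    (hg : (g : G ⧸ H) ∈ (extChartAt 𝓘(ℝ, F) x₀).source) :
    ContMDiffAt 𝓘(ℝ, E) 𝓘(ℝ, F) ∞ (fun a : G ↦ extChartAt 𝓘(ℝ, F) x₀ (a : G ⧸ H)) g :=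
  (contMDiffAt_extChartAt' (by simpa using hg)).comp g hp.contMDiff.contMDiffAt

theorem contMDiffAt_chartDeriv
    (hp : Manifold.IsSubmersion 𝓘(ℝ, E) 𝓘(ℝ, F) ∞ (fun a : G ↦ (a : G ⧸ H))) {x₀ : G ⧸ H} {g : G}
    (hg : (g : G ⧸ H) ∈ (extChartAt 𝓘(ℝ, F) x₀).source) (u : GroupLieAlgebra 𝓘(ℝ, E) G) :
    ContMDiffAt 𝓘(ℝ, E) 𝓘(ℝ, F) ∞ (chartDeriv (E := E) F x₀ u) g :=
  (contMDiffAt_extChartAt_quotientMk hp hg).derivAlong_mulInvariantVectorField u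

theorem chartDeriv_eq
    (hp : Manifold.IsSubmersion 𝓘(ℝ, E) 𝓘(ℝ, F) ∞ (fun a : G ↦ (a : G ⧸ H))) {x₀ : G ⧸ H} {g : G}
    (hg : (g : G ⧸ H) ∈ (extChartAt 𝓘(ℝ, F) x₀).source) (u : m) :
    chartDeriv (E := E) F x₀ (u : GroupLieAlgebra 𝓘(ℝ, E) G) g =
      mfderiv 𝓘(ℝ, F) 𝓘(ℝ, F) (extChartAt 𝓘(ℝ, F) x₀) (g : G ⧸ H)
        (translateToModel (H := H) F m g u) := by
  have h1 : HasMFDerivAt 𝓘(ℝ, F) 𝓘(ℝ, F) (extChartAt 𝓘(ℝ, F) x₀) (g : G ⧸ H)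
      (mfderiv 𝓘(ℝ, F) 𝓘(ℝ, F) (extChartAt 𝓘(ℝ, F) x₀) (g : G ⧸ H)) :=
    ((contMDiffAt_extChartAt' (n := ∞) (by simpa using hg)).mdifferentiableAt
      (by simp)).hasMFDerivAt
  have h2 := (h1.comp g (hasMFDerivAt_quotientMk hp g)).mfderiv
  rw [translateToModel_apply m hp]
  exact congrArg (fun L : E →L[ℝ] F ↦ L (mulInvariantVectorField (m.subtype u) g)) h2

/-- The difference is the derivative of `φ ∘ p` along the left-invariant field of `[u, v]`. By `[𝔪,
𝔪] ⊆ 𝔥 = ker T_e p` and left translation, that field is vertical for `p`. -/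
theorem chartDeriv_commutator [CompleteSpace E]
    (hp : Manifold.IsSubmersion 𝓘(ℝ, E) 𝓘(ℝ, F) ∞ (fun a : G ↦ (a : G ⧸ H)))
    (hm : IsSymmetricDecomposition H m) {x₀ : G ⧸ H} {g : G}
    (hg : (g : G ⧸ H) ∈ (extChartAt 𝓘(ℝ, F) x₀).source) (u v : m) :
    derivAlong (mulInvariantVectorField (u : GroupLieAlgebra 𝓘(ℝ, E) G)) (chartDeriv (E := E) F x₀ v) g =
      derivAlong (mulInvariantVectorField (v : GroupLieAlgebra 𝓘(ℝ, E) G))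
        (chartDeriv (E := E) F x₀ u) g := by
  rw [← sub_eq_zero]
  refine (derivAlong_mulInvariantVectorField_commutator
    (contMDiffAt_extChartAt_quotientMk hp hg) (u : GroupLieAlgebra 𝓘(ℝ, E) G) v).trans ?_
  have hbr := (mem_subgroupLieAlgebra_iff hp _).1 (hm.lie_mem u u.2 v v.2)
  -- The bracket lies in `𝔥` rather than `𝔪`, so the formula is used for the whole Lie algebra.
  refine (chartDeriv_eq (m := ⊤) hp hg ⟨⁅(u : GroupLieAlgebra 𝓘(ℝ, E) G), (v : GroupLieAlgebra 𝓘(ℝ, E) G)⁆, trivial⟩).trans ?_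
  have h0 : translateToModel (H := H) F (⊤ : Submodule ℝ (GroupLieAlgebra 𝓘(ℝ, E) G)) g
      ⟨⁅(u : GroupLieAlgebra 𝓘(ℝ, E) G), (v : GroupLieAlgebra 𝓘(ℝ, E) G)⁆, trivial⟩ = 0 :=
    (congrArg (mfderiv 𝓘(ℝ, F) 𝓘(ℝ, F) (fun x : G ⧸ H ↦ g • x) ((1 : G) : G ⧸ H)) hbr).trans
      (map_zero _)
  rw [h0]
  exact map_zero (mfderiv 𝓘(ℝ, F) 𝓘(ℝ, F) (extChartAt 𝓘(ℝ, F) x₀) (g : G ⧸ H))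

/-- The components in the chart at `x₀` of the bivector field defined by `r`. -/
theorem bivectorEval_inChart
    (hp : Manifold.IsSubmersion 𝓘(ℝ, E) 𝓘(ℝ, F) ∞ (fun a : G ↦ (a : G ⧸ H)))
    {r : ⋀[ℝ]^2 m} {π : BivectorField F (G ⧸ H)}
    (hπ : ∀ g : G, π (g : G ⧸ H) = exteriorPower.map 2 (translateToTangent F m g (g : G ⧸ H)) r)
    {ι : Type*} [Fintype ι] (b : Module.Basis ι ℝ m) {x₀ : G ⧸ H} {g : G}
    (hg : (g : G ⧸ H) ∈ (extChartAt 𝓘(ℝ, F) x₀).source) (α β : Module.Dual ℝ F) :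
    bivectorEval (π.inChart x₀ (extChartAt 𝓘(ℝ, F) x₀ (g : G ⧸ H))) α β =
      ∑ i, ∑ j, bivectorEval r (b.coord i) (b.coord j) * α (chartDeriv (E := E) F x₀ (b i) g) *
        β (chartDeriv (E := E) F x₀ (b j) g) := by
  let L : TangentSpace 𝓘(ℝ, F) (g : G ⧸ H) →ₗ[ℝ] F :=
    (mfderiv 𝓘(ℝ, F) 𝓘(ℝ, F) (extChartAt 𝓘(ℝ, F) x₀) (g : G ⧸ H)).toLinearMap
  let T : m →ₗ[ℝ] TangentSpace 𝓘(ℝ, F) (g : G ⧸ H) := translateToTangent F m g (g : G ⧸ H)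
  have h1 : ∀ x : G ⧸ H, x = g →
      bivectorEval (exteriorPower.map 2 (N := F)
        (mfderiv 𝓘(ℝ, F) 𝓘(ℝ, F) (extChartAt 𝓘(ℝ, F) x₀) x).toLinearMap (π x)) α β =
      bivectorEval (exteriorPower.map 2 L (π (g : G ⧸ H))) α β := by
    rintro _ rfl
    rfl
  have h2 : bivectorEval (exteriorPower.map 2 L (exteriorPower.map 2 T r)) α β =
      bivectorEval r ((α ∘ₗ L) ∘ₗ T) ((β ∘ₗ L) ∘ₗ T) := by
    rw [bivectorEval_map, bivectorEval_map]
  have h3 : ∀ u : m, chartDeriv (E := E) F x₀ u g = L (T u) := chartDeriv_eq hp hg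
  refine (h1 _ ((extChartAt 𝓘(ℝ, F) x₀).left_inv hg)).trans ?_
  rw [hπ]
  refine h2.trans ?_
  rw [bivectorEval_eq_sum b]
  simp only [h3]
  rfl

/-- Near each point, composing with a local section of `p` writes the components as polynomials in
smooth functions. -/
theorem isSmooth_of_translate [FiniteDimensional ℝ E] [FiniteDimensional ℝ F]
    (hp : Manifold.IsSubmersion 𝓘(ℝ, E) 𝓘(ℝ, F) ∞ (fun a : G ↦ (a : G ⧸ H)))
    {r : ⋀[ℝ]^2 m} {π : BivectorField F (G ⧸ H)}
    (hπ : ∀ g : G, π (g : G ⧸ H) = exteriorPower.map 2 (translateToTangent F m g (g : G ⧸ H)) r) :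
    π.IsSmooth := by
  intro x₀ α β y₁ hy₁
  have : FiniteDimensional ℝ (GroupLieAlgebra 𝓘(ℝ, E) G) := inferInstanceAs (FiniteDimensional ℝ E)
  let b := Module.finBasis ℝ m
  let φ := extChartAt 𝓘(ℝ, F) x₀
  obtain ⟨g₁, hg₁⟩ := QuotientGroup.mk_surjective (φ.symm y₁)
  have hs₁ : (g₁ : G ⧸ H) ∈ φ.source := hg₁ ▸ φ.map_target hy₁
  obtain ⟨s, hs, hsg, hps⟩ := (hp.isSubmersionAt g₁).exists_local_section
  have hφs : ContMDiffAt 𝓘(ℝ, F) 𝓘(ℝ, F) ∞ φ.symm y₁ :=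
    (contMDiffOn_extChartAt_symm x₀).contMDiffAt (extChartAt_target_mem_nhds' hy₁)
  have hσ : ContMDiffAt 𝓘(ℝ, F) 𝓘(ℝ, E) ∞ (s ∘ φ.symm) y₁ := by
    refine ContMDiffAt.comp _ ?_ hφs
    rw [← hg₁]; exact hs
  have hσ₁ : (s ∘ φ.symm) y₁ = g₁ := by
    rw [Function.comp_apply, ← hg₁]; exact hsg
  have hcomp : ∀ u : GroupLieAlgebra 𝓘(ℝ, E) G,
      ContDiffAt ℝ ∞ (fun y ↦ chartDeriv (E := E) F x₀ u (s (φ.symm y))) y₁ := by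
    intro u
    rw [← contMDiffAt_iff_contDiffAt]
    refine ContMDiffAt.comp (g := chartDeriv (E := E) F x₀ u) _ ?_ hσ
    change ContMDiffAt _ _ _ _ ((s ∘ φ.symm) y₁)
    rw [hσ₁]
    exact contMDiffAt_chartDeriv hp hs₁ u
  have hdual : ∀ (α : Module.Dual ℝ F) (u : GroupLieAlgebra 𝓘(ℝ, E) G),
      ContDiffAt ℝ ∞ (fun y ↦ α (chartDeriv (E := E) F x₀ u (s (φ.symm y)))) y₁ := fun α u ↦
    (LinearMap.toContinuousLinearMap α).contDiff.contDiffAt.comp y₁ (hcomp u)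
  have hsum : ContDiffAt ℝ ∞ (fun y ↦ ∑ i, ∑ j, bivectorEval r (b.coord i) (b.coord j) *
      α (chartDeriv (E := E) F x₀ (b i) (s (φ.symm y))) * β (chartDeriv (E := E) F x₀ (b j) (s (φ.symm y)))) y₁ :=
    ContDiffAt.sum fun i _ ↦ ContDiffAt.sum fun j _ ↦
      (contDiffAt_const.mul (hdual α _)).mul (hdual β _)
  refine (hsum.congr_of_eventuallyEq ?_).contDiffWithinAt
  have hps' : ∀ᶠ y in 𝓝 y₁, ((s (φ.symm y) : G) : G ⧸ H) = φ.symm y :=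
    hφs.continuousAt.eventually (by rw [← hg₁]; exact hps)
  filter_upwards [hps', extChartAt_target_mem_nhds' hy₁] with y hy hyt
  have hsrc : ((s (φ.symm y) : G) : G ⧸ H) ∈ φ.source := by
    rw [hy]; exact φ.map_target hyt
  have h := bivectorEval_inChart hp hπ b hsrc α β
  rw [hy] at h
  rw [← h]
  exact congrArg (fun z ↦ bivectorEval (π.inChart x₀ z) α β) (φ.right_inv hyt).symm

end InvariantPoisson

/-! ### Chain and Leibniz rules for derivatives along vector fields. -/

section LeibnizRule

open scoped Topology

variable {E : Type*} [NormedAddCommGroup E] [NormedSpace ℝ E]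
  {F : Type*} [NormedAddCommGroup F] [NormedSpace ℝ F]
  {F' : Type*} [NormedAddCommGroup F'] [NormedSpace ℝ F']
  {M : Type*} [TopologicalSpace M] [ChartedSpace E M]

theorem derivAlong_eq_fderiv (V : ∀ x : M, TangentSpace 𝓘(ℝ, E) x) {f : M → F} {x : M}
    (hf : MDifferentiableAt 𝓘(ℝ, E) 𝓘(ℝ, F) f x) :
    derivAlong V f x =
      fderiv ℝ (f ∘ (extChartAt 𝓘(ℝ, E) x).symm) (extChartAt 𝓘(ℝ, E) x x) (V x) := by
  have h : mfderiv 𝓘(ℝ, E) 𝓘(ℝ, F) f x =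
      fderivWithin ℝ (f ∘ (extChartAt 𝓘(ℝ, E) x).symm) (Set.range 𝓘(ℝ, E))
        (extChartAt 𝓘(ℝ, E) x x) := hf.mfderiv
  rw [ModelWithCorners.range_eq_univ, fderivWithin_univ] at h
  exact congrArg (fun L : E →L[ℝ] F ↦ L (V x)) h

theorem differentiableAt_comp_extChartAt_symm {f : M → F} {x : M}
    (hf : MDifferentiableAt 𝓘(ℝ, E) 𝓘(ℝ, F) f x) :
    DifferentiableAt ℝ (f ∘ (extChartAt 𝓘(ℝ, E) x).symm) (extChartAt 𝓘(ℝ, E) x x) := by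
  have h := hf.differentiableWithinAt_writtenInExtChartAt
  rw [ModelWithCorners.range_eq_univ, differentiableWithinAt_univ] at h
  exact h

theorem derivAlong_comp (V : ∀ x : M, TangentSpace 𝓘(ℝ, E) x) {f : M → F} {q : F → F'} {x : M}
    (hf : MDifferentiableAt 𝓘(ℝ, E) 𝓘(ℝ, F) f x) (hq : DifferentiableAt ℝ q (f x)) :
    derivAlong V (fun y ↦ q (f y)) x = fderiv ℝ q (f x) (derivAlong V f x) := by
  have h := (HasMFDerivAt.comp x hq.hasFDerivAt.hasMFDerivAt hf.hasMFDerivAt).mfderiv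
  exact congrArg (fun L : E →L[ℝ] F' ↦ L (V x)) h

theorem derivAlong_congr (V : ∀ x : M, TangentSpace 𝓘(ℝ, E) x) {f₁ f₂ : M → F} {x : M}
    (h : f₁ =ᶠ[𝓝 x] f₂) : derivAlong V f₁ x = derivAlong V f₂ x :=
  congrArg (fun L : E →L[ℝ] F ↦ L (V x)) h.mfderiv_eq

theorem derivAlong_sum_mul [FiniteDimensional ℝ F] {ι : Type*} [Fintype ι]
    (V : ∀ x : M, TangentSpace 𝓘(ℝ, E) x)
    {A : ι → M → F} {x : M} (hA : ∀ i, MDifferentiableAt 𝓘(ℝ, E) 𝓘(ℝ, F) (A i) x)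
    (R : ι → ι → ℝ) (a b : Module.Dual ℝ F)
    (hq : MDifferentiableAt 𝓘(ℝ, E) 𝓘(ℝ, ℝ)
      (fun y ↦ ∑ i, ∑ j, R i j * a (A i y) * b (A j y)) x) :
    derivAlong V (fun y ↦ ∑ i, ∑ j, R i j * a (A i y) * b (A j y)) x =
      ∑ i, ∑ j, R i j * (a (derivAlong V (A i) x) * b (A j x) +
        a (A i x) * b (derivAlong V (A j) x)) := by
  rw [derivAlong_eq_fderiv V hq]
  simp only [derivAlong_eq_fderiv V (hA _)]
  have hd : ∀ (a : Module.Dual ℝ F) (i : ι), HasFDerivAt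
      (fun y ↦ a (A i ((extChartAt 𝓘(ℝ, E) x).symm y)))
      ((LinearMap.toContinuousLinearMap a).comp
        (fderiv ℝ (A i ∘ (extChartAt 𝓘(ℝ, E) x).symm) (extChartAt 𝓘(ℝ, E) x x)))
      (extChartAt 𝓘(ℝ, E) x x) := fun a i ↦
    (LinearMap.toContinuousLinearMap a).hasFDerivAt.comp (extChartAt 𝓘(ℝ, E) x x)
      (differentiableAt_comp_extChartAt_symm (hA i)).hasFDerivAt
  have hsum : HasFDerivAt (fun y ↦ ∑ i, ∑ j, R i j *
      a (A i ((extChartAt 𝓘(ℝ, E) x).symm y)) * b (A j ((extChartAt 𝓘(ℝ, E) x).symm y))) _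
      (extChartAt 𝓘(ℝ, E) x x) :=
    HasFDerivAt.fun_sum fun i _ ↦ HasFDerivAt.fun_sum fun j _ ↦
      ((hd a i).const_mul (R i j)).mul (hd b j)
  have key : ∀ v : E, fderiv ℝ (fun y ↦ ∑ i, ∑ j, R i j *
      a (A i ((extChartAt 𝓘(ℝ, E) x).symm y)) * b (A j ((extChartAt 𝓘(ℝ, E) x).symm y)))
      (extChartAt 𝓘(ℝ, E) x x) v = ∑ i, ∑ j, R i j *
        (a (fderiv ℝ (A i ∘ (extChartAt 𝓘(ℝ, E) x).symm) (extChartAt 𝓘(ℝ, E) x x) v) * b (A j x) +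
        a (A i x) *
          b (fderiv ℝ (A j ∘ (extChartAt 𝓘(ℝ, E) x).symm) (extChartAt 𝓘(ℝ, E) x x) v)) := by
    intro v
    rw [hsum.fderiv]
    simp only [sum_apply, add_apply, smul_apply, ContinuousLinearMap.comp_apply,
      LinearMap.coe_toContinuousLinearMap', smul_eq_mul, extChartAt_to_inv]
    refine Finset.sum_congr rfl fun i _ ↦ Finset.sum_congr rfl fun j _ ↦ ?_
    ring
  exact key (V x)

end LeibnizRule

/-! ### Vanishing of the Schouten bracket. -/

section SchoutenVanishing

open scoped Topology

variable {E : Type*} [NormedAddCommGroup E] [NormedSpace ℝ E] [FiniteDimensional ℝ E]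
  {G : Type*} [TopologicalSpace G] [ChartedSpace E G] [Group G] [LieGroup 𝓘(ℝ, E) ∞ G]
  {H : Subgroup G}
  {F : Type*} [NormedAddCommGroup F] [NormedSpace ℝ F] [FiniteDimensional ℝ F]
  [ChartedSpace F (G ⧸ H)] [IsManifold 𝓘(ℝ, F) ∞ (G ⧸ H)]
  {m : Submodule ℝ (GroupLieAlgebra 𝓘(ℝ, E) G)}

theorem vectorSpaceSchouten_inChart_eq_zero
    (hp : Manifold.IsSubmersion 𝓘(ℝ, E) 𝓘(ℝ, F) ∞ (fun a : G ↦ (a : G ⧸ H)))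
    (hm : IsSymmetricDecomposition H m)
    {r : ⋀[ℝ]^2 m} {π : BivectorField F (G ⧸ H)}
    (hπ : ∀ g : G, π (g : G ⧸ H) = exteriorPower.map 2 (translateToTangent F m g (g : G ⧸ H)) r)
    (x₀ : G ⧸ H) (a b c : Module.Dual ℝ F) :
    vectorSpaceSchouten (π.inChart x₀) (π.inChart x₀) (extChartAt 𝓘(ℝ, F) x₀ x₀) a b c = 0 := by
  have : FiniteDimensional ℝ (GroupLieAlgebra 𝓘(ℝ, E) G) := inferInstanceAs (FiniteDimensional ℝ E)
  have : CompleteSpace E := FiniteDimensional.complete ℝ E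
  let e := Module.finBasis ℝ m
  let φ := extChartAt 𝓘(ℝ, F) x₀
  obtain ⟨g, hg⟩ := QuotientGroup.mk_surjective x₀
  have hsrc : (g : G ⧸ H) ∈ φ.source := hg ▸ mem_extChartAt_source x₀
  have hφp := contMDiffAt_extChartAt_quotientMk hp hsrc
  let R : Fin (Module.finrank ℝ m) → Fin (Module.finrank ℝ m) → ℝ :=
    fun i j ↦ bivectorEval r (e.coord i) (e.coord j)
  let A : Fin (Module.finrank ℝ m) → G → F := fun i ↦ chartDeriv (E := E) F x₀ (e i)
  let D : Fin (Module.finrank ℝ m) → Fin (Module.finrank ℝ m) → F := fun k i ↦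
    derivAlong (mulInvariantVectorField (e k : GroupLieAlgebra 𝓘(ℝ, E) G)) (A i) g
  have hA : ∀ i, MDifferentiableAt 𝓘(ℝ, E) 𝓘(ℝ, F) (A i) g := fun i ↦
    (contMDiffAt_chartDeriv hp hsrc _).mdifferentiableAt (by simp)
  have hD : ∀ i j, D i j = D j i := fun i j ↦ chartDeriv_commutator hp hm hsrc (e i) (e j)
  have hR : ∀ i j, R j i = - R i j := fun i j ↦ bivectorEval_swap _ _ _
  let Q : Module.Dual ℝ F → Module.Dual ℝ F → F → ℝ := fun a b y ↦
    bivectorEval (π.inChart x₀ y) a b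
  have hQ : ∀ a b, DifferentiableAt ℝ (Q a b) (φ (g : G ⧸ H)) := by
    intro a b
    have h1 := (isSmooth_of_translate hp hπ x₀ a b).contDiffAt
      (extChartAt_target_mem_nhds' (φ.map_source hsrc))
    exact h1.differentiableAt (by simp)
  have hQeq : ∀ a b, (fun g' : G ↦ Q a b (φ (g' : G ⧸ H))) =ᶠ[𝓝 g]
      fun g' ↦ ∑ i, ∑ j, R i j * a (A i g') * b (A j g') := by
    intro a b
    have h1 : ∀ᶠ g' : G in 𝓝 g, (g' : G ⧸ H) ∈ φ.source :=
      hp.contMDiff.continuous.continuousAt.eventually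
        ((isOpen_extChartAt_source x₀).mem_nhds hsrc)
    filter_upwards [h1] with g' hg'
    exact bivectorEval_inChart hp hπ e hg' a b
  -- `A k g` is the image under `T(φ ∘ p)` of the left-invariant field of `e k`, so this directional
  -- derivative can be taken on `G`, where the components are explicit sums.
  have hdQ : ∀ a b k, fderiv ℝ (Q a b) (φ (g : G ⧸ H)) (A k g) =
      ∑ i, ∑ j, R i j * (a (D k i) * b (A j g) + a (A i g) * b (D k j)) := by
    intro a b k
    have hφd := hφp.mdifferentiableAt (by simp)
    rw [← derivAlong_sum_mul _ hA, ← derivAlong_congr _ (hQeq a b)]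
    · exact (derivAlong_comp _ hφd (hQ a b)).symm
    · refine MDifferentiableAt.congr_of_eventuallyEq ?_ (hQeq a b).symm
      exact MDifferentiableAt.comp (g := Q a b) g (hQ a b).mdifferentiableAt hφd
  have hS : ∀ a b c, bivectorEval (π.inChart x₀ (φ (g : G ⧸ H)))
      (fderiv ℝ (Q a b) (φ (g : G ⧸ H)) : F →ₗ[ℝ] ℝ) c =
      ∑ k, ∑ l, R k l * (∑ i, ∑ j, R i j * (a (D k i) * b (A j g) + a (A i g) * b (D k j))) *
        c (A l g) := by
    intro a b c
    rw [bivectorEval_inChart hp hπ e hsrc]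
    simp only [ContinuousLinearMap.coe_coe]
    refine Finset.sum_congr rfl fun k _ ↦ Finset.sum_congr rfl fun l _ ↦ ?_
    rw [← hdQ]
  have hcyc := cyclic_sum_eq_zero R hR D hD (fun i ↦ A i g) a b c
  simp only [← hS] at hcyc
  have hx : extChartAt 𝓘(ℝ, F) x₀ x₀ = φ (g : G ⧸ H) := by rw [hg]
  rw [hx]
  simp only [vectorSpaceSchouten]
  -- With equal arguments the two terms of the bracket agree, so it is twice the cyclic sum in
  -- `hcyc`.
  linarith

theorem isPoisson_of_translate
    (hp : Manifold.IsSubmersion 𝓘(ℝ, E) 𝓘(ℝ, F) ∞ (fun a : G ↦ (a : G ⧸ H)))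
    (hm : IsSymmetricDecomposition H m)
    {r : ⋀[ℝ]^2 m} {π : BivectorField F (G ⧸ H)}
    (hπ : ∀ g : G, π (g : G ⧸ H) = exteriorPower.map 2 (translateToTangent F m g (g : G ⧸ H)) r) :
    π.IsPoisson :=
  ⟨isSmooth_of_translate hp hπ, fun x _ _ _ ↦ vectorSpaceSchouten_inChart_eq_zero hp hm hπ x _ _ _⟩

end SchoutenVanishing

/-! ### Invariant bivector fields and their values at the base point. -/

section InvariantBivectorFields

variable {E : Type*} [NormedAddCommGroup E] [NormedSpace ℝ E]
  {G : Type*} [TopologicalSpace G] [ChartedSpace E G] [Group G] [LieGroup 𝓘(ℝ, E) ∞ G]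
  {H : Subgroup G}
  {F : Type*} [NormedAddCommGroup F] [NormedSpace ℝ F]
  [ChartedSpace F (G ⧸ H)] [IsManifold 𝓘(ℝ, F) ∞ (G ⧸ H)]
  {m : Submodule ℝ (GroupLieAlgebra 𝓘(ℝ, E) G)}

theorem smul_mk_one_eq {G : Type*} [Group G] {H : Subgroup G} (g : G) : g • ((1 : G) : G ⧸ H) = (g : G ⧸ H) := by
  change ((g * 1 : G) : G ⧸ H) = g
  rw [mul_one]

theorem translateToTangent_mul
    (hp : Manifold.IsSubmersion 𝓘(ℝ, E) 𝓘(ℝ, F) ∞ (fun a : G ↦ (a : G ⧸ H))) (g a : G) :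
    translateToTangent (H := H) F m (g * a) (g • (a : G ⧸ H)) =
      (mfderiv 𝓘(ℝ, F) 𝓘(ℝ, F) (fun x : G ⧸ H ↦ g • x) (a : G ⧸ H)).toLinearMap ∘ₗ
        translateToTangent F m a (a : G ⧸ H) :=
  translateToModel_mul m hp g a

theorem translateToTangent_mul_mem
    (hp : Manifold.IsSubmersion 𝓘(ℝ, E) 𝓘(ℝ, F) ∞ (fun a : G ↦ (a : G ⧸ H)))
    (hm : IsSymmetricDecomposition H m) (g : G) (a : H) (x : G ⧸ H) :
    translateToTangent F m (g * a) x = translateToTangent F m g x ∘ₗ hm.groupAdRestrict a :=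
  translateToModel_mul_mem hp hm g a

theorem translateToTangent_one_bijective
    (hp : Manifold.IsSubmersion 𝓘(ℝ, E) 𝓘(ℝ, F) ∞ (fun a : G ↦ (a : G ⧸ H)))
    (hm : IsSymmetricDecomposition H m) (x : G ⧸ H) :
    Function.Bijective (translateToTangent F m 1 x) := by
  have h := projTangent_bijective (F := F) hp hm
  rw [← translateToModel_one m hp] at h
  exact h

/-- The bivector field on `G ⧸ H` defined by `r`, using a choice of representatives. -/
def translatedBivectorField (F : Type*) [NormedAddCommGroup F] [NormedSpace ℝ F]
    [ChartedSpace F (G ⧸ H)] (r : ⋀[ℝ]^2 m) : BivectorField F (G ⧸ H) :=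
  fun x ↦ exteriorPower.map 2 (translateToTangent F m x.out x) r

/-- Two representatives of a coset differ by some `a ∈ H`, which changes the translation map by
`Ad_a`; this fixes `r`. -/
theorem translatedBivectorField_apply
    (hp : Manifold.IsSubmersion 𝓘(ℝ, E) 𝓘(ℝ, F) ∞ (fun a : G ↦ (a : G ⧸ H)))
    (hm : IsSymmetricDecomposition H m) (r : hm.invariantBivectors) (g : G) {x : G ⧸ H}
    (hx : (g : G ⧸ H) = x) :
    translatedBivectorField F (r : ⋀[ℝ]^2 m) x =
      exteriorPower.map 2 (translateToTangent F m g x) (r : ⋀[ℝ]^2 m) := by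
  obtain ⟨a, ha⟩ := QuotientGroup.mk_out_eq_mul H g
  rw [hx] at ha
  rw [translatedBivectorField, ha, translateToTangent_mul_mem hp hm, bivector_map_comp_apply, r.2 a]

theorem translatedBivectorField_isInvariant
    (hp : Manifold.IsSubmersion 𝓘(ℝ, E) 𝓘(ℝ, F) ∞ (fun a : G ↦ (a : G ⧸ H)))
    (hm : IsSymmetricDecomposition H m) (r : hm.invariantBivectors) :
    (translatedBivectorField (H := H) F (r : ⋀[ℝ]^2 m)).IsInvariant G := by
  intro g x
  obtain ⟨a, rfl⟩ := QuotientGroup.mk_surjective x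
  have h1 : ((g * a : G) : G ⧸ H) = g • (a : G ⧸ H) := rfl
  rw [translatedBivectorField_apply hp hm r (g * a) h1, translatedBivectorField_apply hp hm r a rfl,
    translateToTangent_mul hp, bivector_map_comp_apply]

/-- By transitivity, an invariant field is determined by its value at `ē`. -/
theorem BivectorField.IsInvariant.eq_map
    (hp : Manifold.IsSubmersion 𝓘(ℝ, E) 𝓘(ℝ, F) ∞ (fun a : G ↦ (a : G ⧸ H)))
    {π : BivectorField F (G ⧸ H)} (hπ : π.IsInvariant G) {r : ⋀[ℝ]^2 m}
    (hr : exteriorPower.map 2 (translateToTangent F m 1 ((1 : G) : G ⧸ H)) r =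
      π ((1 : G) : G ⧸ H))
    (g : G) {x : G ⧸ H} (hx : (g : G ⧸ H) = x) :
    π x = exteriorPower.map 2 (translateToTangent F m g x) r := by
  obtain rfl := (smul_mk_one_eq g).trans hx
  have h1 := translateToTangent_mul (m := m) hp g 1
  rw [mul_one] at h1
  rw [hπ, ← hr, h1, bivector_map_comp_apply]

end InvariantBivectorFields

end

/-! ### The bijection. -/

theorem mainTheorem5
    {E : Type*} [NormedAddCommGroup E] [NormedSpace ℝ E] [FiniteDimensional ℝ E]
    {G : Type*} [TopologicalSpace G] [ChartedSpace E G] [Group G] [LieGroup 𝓘(ℝ, E) ∞ G]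
    [ConnectedSpace G]
    (H : Subgroup G) (hH : IsClosed (H : Set G))
    -- the quotient manifold structure on `G/H`: the one making `G → G/H` a smooth submersion
    {F : Type*} [NormedAddCommGroup F] [NormedSpace ℝ F] [FiniteDimensional ℝ F]
    [ChartedSpace F (G ⧸ H)] [IsManifold 𝓘(ℝ, F) ∞ (G ⧸ H)]
    (hp : Manifold.IsSubmersion 𝓘(ℝ, E) 𝓘(ℝ, F) ∞ (fun a : G ↦ (a : G ⧸ H)))
    (m : Submodule ℝ (GroupLieAlgebra 𝓘(ℝ, E) G))
    (hm : IsSymmetricDecomposition H m) :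
    ∃ Φ : hm.invariantBivectors ≃
        {π : BivectorField F (G ⧸ H) // π.IsPoisson ∧ π.IsInvariant G},
      ∀ (r : hm.invariantBivectors) (g : G),
        (Φ r).1 (g • ((1 : G) : G ⧸ H)) =
          exteriorPower.map 2 (translateToQuotient F m g) (r : ⋀[ℝ]^2 m) := by
  let e₀ : G ⧸ H := ((1 : G) : G ⧸ H)
  have hbij := translateToTangent_one_bijective (F := F) hp hm e₀
  have hinj : Function.Injective (exteriorPower.map 2 (translateToTangent F m 1 e₀)) :=
    exteriorPower.map_injective_field hbij.1
  let Ψ : hm.invariantBivectors →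
      {π : BivectorField F (G ⧸ H) // π.IsPoisson ∧ π.IsInvariant G} := fun r ↦
    ⟨translatedBivectorField F (r : ⋀[ℝ]^2 m),
      isPoisson_of_translate hp hm fun g ↦ translatedBivectorField_apply hp hm r g rfl,
      translatedBivectorField_isInvariant hp hm r⟩
  have hΨ : Function.Bijective Ψ := by
    constructor
    · intro r s hrs
      have h1 : translatedBivectorField F (r : ⋀[ℝ]^2 m) e₀ =
          translatedBivectorField F (s : ⋀[ℝ]^2 m) e₀ :=
        congrFun (congrArg Subtype.val hrs) e₀
      rw [translatedBivectorField_apply hp hm r 1 rfl,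
        translatedBivectorField_apply hp hm s 1 rfl] at h1
      exact Subtype.ext (hinj h1)
    · rintro ⟨π, hP, hI⟩
      obtain ⟨r, hr⟩ := exteriorPower.map_surjective (n := 2) hbij.2 (π e₀)
      -- Both `1` and `a` represent `ē`, so `π ē` is the image under `T_e p` of `r` and also of
      -- `∧²(Ad_a) r`; injectivity equates them.
      have hmem : r ∈ hm.invariantBivectors := by
        intro a
        apply hinj
        have ha : ((a : G) : G ⧸ H) = e₀ :=
          QuotientGroup.eq.2 (H.mul_mem (H.inv_mem a.2) H.one_mem)
        have h1 := hI.eq_map hp hr (a : G) ha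
        have h2 := translateToTangent_mul_mem (F := F) hp hm 1 a e₀
        rw [one_mul] at h2
        rw [h2, bivector_map_comp_apply] at h1
        rw [← h1, hr]
      refine ⟨⟨r, hmem⟩, Subtype.ext (funext fun x ↦ ?_)⟩
      obtain ⟨g, rfl⟩ := QuotientGroup.mk_surjective x
      exact (translatedBivectorField_apply hp hm ⟨r, hmem⟩ g rfl).trans (hI.eq_map hp hr g rfl).symm
  exact ⟨Equiv.ofBijective Ψ hΨ, fun r g ↦
    translatedBivectorField_apply hp hm r g (smul_mk_one_eq g).symm⟩
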